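/- Let $G$ be an unknown undirected loopless multigraph on the vertex set $\{1,\dots,n\}$, $n\ge 1$. An $\mathsf{OR}$ query specifies a set $S$ of unordered pairs of distinct vertices and returns whether $G$ has at least one edge joining the two vertices of some pair in $S$. A $\mathsf{BIS}$ query specifies two disjoint vertex sets $A,B$ and returns whether $G$ has an edge with one endpoint in $A$ and the other in $B$. An $r$-round randomized algorithm first draws a random seed and then proceeds in $r$ rounds; in each round it submits finitely many queries simultaneously, which may depend only on the seed and on the answers received in earlier rounds, and after the last round it returns an output determined by the seed and all the answers. A spanning forest of $G$ is an acyclic simple graph on $\{1,\dots,n\}$ each of whose edges joins two vertices adjacent in $G$, and which has the same connected components as $G$. For every $c\in\mathbb N$ there is a constant $C=C(c)$ such that for every $n\ge 1$: 1. there is a $2$-round randomized algorithm using $\mathsf{OR}$ queries which, on every multigraph $G$ on $\{1,\dots,n\}$, makes at most $C\,n\log^5 n$ queries in total (for every outcome of its randomness) and returns a spanning forest of $G$ with probability at least $1-n^{-c}$; 2. there is a $4$-round randomized algorithm using $\mathsf{BIS}$ queries which, on every multigraph $G$ on $\{1,\dots,n\}$, makes at most $C\,n\log^5 n$ queries in total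 (for every outcome of its randomness) and returns a spanning forest of $G$ with probability at least $1-n^{-c}$. -/

import Mathlib

open scoped ENNReal

/-- An undirected (loopless) multigraph on `n` labelled vertices: every unordered pair of distinct
vertices carries a number of parallel edges. -/
structure Multigraph (n : ℕ) where
  /-- The number of parallel edges between the two vertices of a pair. -/
  mult : Sym2 (Fin n) → ℕ
  loopless : ∀ v : Fin n, mult s(v, v) = 0

/-- The simple graph underlying a multigraph: two vertices are adjacent when there is at least one
edge between them. -/
def Multigraph.toSimpleGraph {n : ℕ} (G : Multigraph n) : SimpleGraph (Fin n) where
  Adj u v := 0 < G.mult s(u, v)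
  symm := ⟨fun u v h => by rw [Sym2.eq_swap]; exact h⟩
  loopless := ⟨fun v h => by simp [G.loopless v] at h⟩

/-- `T` is a spanning forest of `G`: its edges are edges of `G`, it has no cycle, and it has the
same connected components as `G`. -/
def Multigraph.IsSpanningForest {n : ℕ} (G : Multigraph n) (T : SimpleGraph (Fin n)) : Prop :=
  T ≤ G.toSimpleGraph ∧ T.IsAcyclic ∧
    ∀ u v : Fin n, T.Reachable u v ↔ G.toSimpleGraph.Reachable u v

/-- An `OR` query: an arbitrary set of unordered pairs of distinct vertices. -/
abbrev ORQuery (n : ℕ) : Type := Finset {e : Sym2 (Fin n) // ¬ e.IsDiag}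

/-- The answer to an `OR` query: does some pair in the set carry an edge of `G`? -/
def Multigraph.answerOR {n : ℕ} (G : Multigraph n) (S : ORQuery n) : Bool :=
  decide (∃ e ∈ S, 0 < G.mult e.1)

/-- A `BIS` (bipartite independent set) query: two disjoint sets of vertices. -/
structure BISQuery (n : ℕ) where
  left : Finset (Fin n)
  right : Finset (Fin n)
  disjoint : Disjoint left right

/-- The answer to a `BIS` query: does `G` have an edge with one endpoint in each of the two sets? -/
def Multigraph.answerBIS {n : ℕ} (G : Multigraph n) (q : BISQuery n) : Bool :=
  decide (∃ a ∈ q.left, ∃ b ∈ q.right, 0 < G.mult s(a, b))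

/-- Deterministic `r`-round algorithms that ask yes/no queries from `Q` and return an element of
`O`. In a round the algorithm submits finitely many queries at once; the queries of later rounds
and the output depend on the input only through the answers received so far. -/
inductive RoundAlgorithm (Q O : Type) : ℕ → Type where
  | output (o : O) : RoundAlgorithm Q O 0
  | round {r : ℕ} (k : ℕ) (query : Fin k → Q)
      (next : (Fin k → Bool) → RoundAlgorithm Q O r) : RoundAlgorithm Q O (r + 1)

namespace RoundAlgorithm

/-- The output of the algorithm when its queries are answered by `oracle`. -/
def run {Q O : Type} (oracle : Q → Bool) : {r : ℕ} → RoundAlgorithm Q O r → O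
  | _, output o => o
  | _, round _ query next => run oracle (next fun i => oracle (query i))

/-- The total number of queries, over all rounds, that the algorithm makes when its queries are
answered by `oracle`. -/
def numQueries {Q O : Type} (oracle : Q → Bool) : {r : ℕ} → RoundAlgorithm Q O r → ℕ
  | _, output _ => 0
  | _, round k query next => k + numQueries oracle (next fun i => oracle (query i))

end RoundAlgorithm

/-- A randomized `r`-round algorithm: a random seed is drawn from a discrete distribution and the
deterministic algorithm belonging to the seed is run. -/
structure RandomizedAlgorithm (Q O : Type) (r : ℕ) where
  Seed : Type
  law : PMF Seed
  algorithm : Seed → RoundAlgorithm Q O r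

namespace RandomizedAlgorithm

/-- The probability that the output fails the property `P` when the queries are answered by
`oracle`. -/
noncomputable def failureProb {Q O : Type} {r : ℕ} (A : RandomizedAlgorithm Q O r)
    (oracle : Q → Bool) (P : O → Prop) : ℝ≥0∞ :=
  A.law.toOuterMeasure {ω | ¬ P ((A.algorithm ω).run oracle)}

/-- For every seed, the algorithm makes at most `b` queries in total when they are answered by
`oracle`. -/
def MakesAtMost {Q O : Type} {r : ℕ} (A : RandomizedAlgorithm Q O r)
    (oracle : Q → Bool) (b : ℝ) : Prop :=
  ∀ ω : A.Seed, (((A.algorithm ω).numQueries oracle : ℕ) : ℝ) ≤ b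

end RandomizedAlgorithm

/-! Only the simple graph `Γ` underlying `G` matters. In the first round every vertex repeatedly
samples a random vertex set at a random dyadic density. Asking for each bit position and bit value
whether it has a neighbour there reveals that neighbour whenever it is unique. Let `H` be the graph
of all edges found.

The key claim is that, with high probability, only O(n log n) edges of `Γ` join different components
of `H`. By `exists_wellConnected_subgraph`, `Γ` has a subgraph `F` missing only O(n log n) edges
such that every cut crossed by `F` has at least constant weight, where an edge weighs 1/deg(v) at
each end v, with degrees taken in `Γ`. To obtain `F`, sparse cuts and vertices that have lost most
of their edges are deleted while a budget holds: a sparse cut is paid for by the sum of the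
logarithms of the component sizes, an isolation by the original degree of the vertex. A vertex
samples a given edge as its unique one with probability of order 1/(deg log n), so one stage finds
an edge across any such cut with probability of order 1/log n (`pr_hits_stageGraph_ge`). As in
Borůvka's algorithm, each stage then shrinks the expected number of components that `F` leaves by a
factor 1 - Ω(1/log n) (`pr_not_contracted_le`). O(log² n) stages contract `F`, and only edges
outside `F` can remain.

The few remaining edges are recovered by group testing (`pr_groupTest_fail_le`): every non-edge lies
in some negative test. `OR` queries test arbitrary sets of pairs, so a second round suffices. `BIS`
queries test one vertex against a set, so a round estimating the number of remaining edges at each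
vertex comes first and sets the test density there. The fourth round stays empty. -/

/-! ### Uniform probability on finite types -/

section Probability

open scoped Classical

/-- The probability of an event under the uniform distribution on a finite type. -/
noncomputable def pr {Ω : Type} [Fintype Ω] (P : Ω → Prop) : ℝ :=
  ((Finset.univ.filter P).card : ℝ) / Fintype.card Ω

variable {Ω Ω' ι : Type} [Fintype Ω] [Fintype Ω'] [Fintype ι]

lemma pr_eq (P : Ω → Prop) [DecidablePred P] :
    pr P = ((Finset.univ.filter P).card : ℝ) / Fintype.card Ω := by
  unfold pr
  congr

lemma pr_nonneg (P : Ω → Prop) : 0 ≤ pr P := by unfold pr; positivity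

lemma pr_mono {P Q : Ω → Prop} (h : ∀ ω, P ω → Q ω) : pr P ≤ pr Q := by
  unfold pr
  gcongr
  exact h _

lemma pr_le_one (P : Ω → Prop) : pr P ≤ 1 := by
  unfold pr
  apply div_le_one_of_le₀ _ (by positivity)
  exact_mod_cast Finset.card_le_univ _

lemma pr_not [Nonempty Ω] (P : Ω → Prop) : pr (fun ω => ¬ P ω) = 1 - pr P := by
  rw [pr_eq, pr_eq]
  have h := Finset.card_filter_add_card_filter_not (s := (Finset.univ : Finset Ω)) P
  have hc : (0 : ℝ) < Fintype.card Ω := by exact_mod_cast Fintype.card_pos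
  rw [Finset.card_univ] at h
  have h' : ((Finset.univ.filter P).card : ℝ) + (Finset.univ.filter fun ω => ¬ P ω).card
      = Fintype.card Ω := by exact_mod_cast h
  field_simp
  linarith

lemma pr_eq_expect (P : Ω → Prop) :
    pr P = (∑ ω, if P ω then (1 : ℝ) else 0) / Fintype.card Ω := by
  simp [pr]

lemma pr_exists_le (P : ι → Ω → Prop) : pr (fun ω => ∃ i, P i ω) ≤ ∑ i, pr (P i) := by
  simp only [pr_eq, ← Finset.sum_div]
  gcongr
  have : (Finset.univ.filter fun ω => ∃ i, P i ω)
      = Finset.univ.biUnion fun i => Finset.univ.filter (P i) := by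
    ext ω; simp
  rw [this]
  exact_mod_cast Finset.card_biUnion_le

lemma pr_exists_le_of_forall_le (P : ι → Ω → Prop) {δ : ℝ} (h : ∀ i, pr (P i) ≤ δ) :
    pr (fun ω => ∃ i, P i ω) ≤ Fintype.card ι * δ := by
  refine (pr_exists_le P).trans ((Finset.sum_le_sum fun i _ => h i).trans ?_)
  simp

lemma pr_prod (P : Ω × Ω' → Prop) :
    pr P = (∑ a, pr fun b => P (a, b)) / Fintype.card Ω := by
  simp only [pr_eq_expect, Fintype.sum_prod_type, Fintype.card_prod, Nat.cast_mul]
  rw [← Finset.sum_div, div_div, mul_comm (Fintype.card Ω' : ℝ)]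

/-- Conditioning on the seed of the earlier rounds: a bad seed costs at most probability one, a good
one at most `δ`. The analysis of successive rounds is chained through this bound. -/
lemma pr_prod_le [Nonempty Ω] (P : Ω × Ω' → Prop) (B : Ω → Prop) {δ : ℝ} (hδ : 0 ≤ δ)
    (h : ∀ a, ¬ B a → pr (fun b => P (a, b)) ≤ δ) : pr P ≤ pr B + δ := by
  rw [pr_prod, pr_eq_expect]
  have hc : (0 : ℝ) < Fintype.card Ω := by exact_mod_cast Fintype.card_pos
  rw [div_add' _ _ _ hc.ne']
  gcongr
  have : δ * (Fintype.card Ω : ℝ) = ∑ _a : Ω, δ := by simp [mul_comm]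
  rw [this, ← Finset.sum_add_distrib]
  refine Finset.sum_le_sum fun a _ => ?_
  by_cases hB : B a
  · simp only [hB, if_true]
    linarith [pr_le_one fun b => P (a, b)]
  · simpa [hB] using h a hB

variable [DecidableEq ι]

lemma pr_pi [Nonempty Ω] (J : Finset ι) (P : ι → Ω → Prop) :
    pr (fun ω : ι → Ω => ∀ i ∈ J, P i (ω i)) = ∏ i ∈ J, pr (P i) := by
  have hc : (Fintype.card Ω : ℝ) ≠ 0 := by exact_mod_cast Fintype.card_ne_zero
  have h1 : (Finset.univ.filter fun ω : ι → Ω => ∀ i ∈ J, P i (ω i))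
      = Fintype.piFinset fun i => Finset.univ.filter fun x => i ∈ J → P i x := by
    ext ω; simp
  have h2 : ∏ i ∈ J, pr (P i) = ∏ i, if i ∈ J then pr (P i) else 1 := by
    simp [Finset.prod_ite_mem]
  rw [pr_eq, h1, Fintype.card_piFinset, h2, Fintype.card_fun, Nat.cast_prod, Nat.cast_pow]
  rw [← Finset.card_univ (α := ι), ← Finset.prod_const, ← Finset.prod_div_distrib]
  refine Finset.prod_congr rfl fun i _ => ?_
  by_cases hi : i ∈ J
  · simp [hi, pr]
  · simp [hi, hc]

lemma pr_coord [Nonempty Ω] (i : ι) (P : Ω → Prop) :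
    pr (fun ω : ι → Ω => P (ω i)) = pr P := by
  simpa using pr_pi {i} fun _ => P

lemma one_sub_mul_le_pow {p : ℝ} (h1 : p ≤ 1) (d : ℕ) : 1 - d * p ≤ (1 - p) ^ d := by
  have := one_add_mul_le_pow (a := -p) (by linarith) d
  simpa [sub_eq_add_neg] using this

/-- A random subset of density `p` contains a given point and avoids `D`. -/
lemma pr_hit_avoid [Nonempty Ω] (A : Ω → Prop) (e : ι) (D : Finset ι) (he : e ∉ D) :
    pr (fun ω : ι → Ω => A (ω e) ∧ ∀ e' ∈ D, ¬ A (ω e')) = pr A * (1 - pr A) ^ D.card := by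
  have := pr_pi (Ω := Ω) (insert e D) fun i x => if i = e then A x else ¬ A x
  rw [Finset.prod_insert he] at this
  have h2 : ∏ i ∈ D, pr (fun x : Ω => if i = e then A x else ¬ A x) = (1 - pr A) ^ D.card := by
    rw [← Finset.prod_const]
    refine Finset.prod_congr rfl fun i hi => ?_
    have : i ≠ e := fun h => he (h ▸ hi)
    simp [this, pr_not]
  rw [h2] at this
  simp only [if_true] at this
  rw [← this]
  congr 1
  ext ω
  simp only [Finset.mem_insert, forall_eq_or_imp, if_true]
  refine and_congr_right fun _ => forall₂_congr fun i hi => ?_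
  have : i ≠ e := fun h => he (h ▸ hi)
  simp [this]

lemma pr_avoid [Nonempty Ω] (A : Ω → Prop) (D : Finset ι) :
    pr (fun ω : ι → Ω => ∀ e' ∈ D, ¬ A (ω e')) = (1 - pr A) ^ D.card := by
  rw [pr_pi D fun _ x => ¬ A x]
  simp [pr_not]

lemma pow_one_sub_le_exp {p : ℝ} (h1 : p ≤ 1) (d : ℕ) : (1 - p) ^ d ≤ Real.exp (-(d * p)) := by
  have h := Real.add_one_le_exp (-p)
  calc (1 - p) ^ d ≤ (Real.exp (-p)) ^ d := by
        apply pow_le_pow_left₀ (by linarith); linarith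
    _ = _ := by rw [← Real.exp_nat_mul]; ring_nf

lemma exp_neg_le_two_pow_inv (k : ℕ) : Real.exp (-(k : ℝ)) ≤ ((2 : ℝ) ^ k)⁻¹ := by
  rw [Real.exp_neg]
  gcongr
  have h := Real.add_one_le_exp (1 : ℝ)
  calc (2 : ℝ) ^ k ≤ (Real.exp 1) ^ k := by gcongr; linarith
    _ = _ := by rw [← Real.exp_nat_mul]; simp

/-- Uniform probability on a finite type bounds the outer measure of the uniform `PMF`. -/
lemma uniform_toOuterMeasure_le [Nonempty Ω] (P : Ω → Prop) {b : ℝ} (h : pr P ≤ b) :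
    (PMF.uniformOfFintype Ω).toOuterMeasure {ω | P ω} ≤ ENNReal.ofReal b := by
  refine le_trans (le_of_eq ?_) (ENNReal.ofReal_le_ofReal h)
  rw [PMF.toOuterMeasure_uniformOfFintype_apply, pr, ENNReal.ofReal_div_of_pos
    (by exact_mod_cast Fintype.card_pos), ENNReal.ofReal_natCast, ENNReal.ofReal_natCast]
  congr 2
  rw [Fintype.card_subtype]
  congr

end Probability

/-! ### A well-connected subgraph missing few edges -/

section Decomposition

open scoped Classical

variable {V : Type}

/-- The graph `F` without the edges between `S` and its complement. -/
def cutDelete (F : SimpleGraph V) (S : Finset V) : SimpleGraph V where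
  Adj u v := F.Adj u v ∧ (u ∈ S ↔ v ∈ S)
  symm := ⟨fun _ _ h => ⟨h.1.symm, h.2.symm⟩⟩
  loopless := ⟨fun _ h => h.1.ne rfl⟩

lemma cutDelete_le (F : SimpleGraph V) (S : Finset V) : cutDelete F S ≤ F := fun _ _ h => h.1

/-- Reachability preserves every predicate that adjacency preserves. -/
lemma reachable_induction {F : SimpleGraph V} {P : V → Prop} (h : ∀ u v, F.Adj u v → P u → P v)
    {u v : V} (huv : F.Reachable u v) (hu : P u) : P v := by
  obtain ⟨w⟩ := huv
  induction w with
  | nil => exact hu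
  | cons hadj _ ih => exact ih (h _ _ hadj hu)

variable [Fintype V]

/-- The neighbours of `v` in `F`. -/
noncomputable def nbrs (F : SimpleGraph V) (v : V) : Finset V := Finset.univ.filter (F.Adj v)

/-- The neighbours of `v` in `F` that `S` separates from `v`. -/
noncomputable def crossing (F : SimpleGraph V) (S : Finset V) (v : V) : Finset V :=
  Finset.univ.filter fun u => F.Adj v u ∧ ¬ (v ∈ S ↔ u ∈ S)

/-- The vertices reachable from `v` in `F`. -/
noncomputable def comp (F : SimpleGraph V) (v : V) : Finset V :=
  Finset.univ.filter (F.Reachable v)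

lemma card_nbrs_cutDelete (F : SimpleGraph V) (S : Finset V) (v : V) :
    (nbrs (cutDelete F S) v).card + (crossing F S v).card = (nbrs F v).card := by
  unfold nbrs crossing
  rw [← Finset.card_union_of_disjoint]
  · congr 1
    ext u
    simp only [Finset.mem_union, Finset.mem_filter, Finset.mem_univ, true_and]
    simp only [cutDelete]
    tauto
  · rw [Finset.disjoint_filter]
    rintro u - h1 h2
    exact h2.2 h1.2

lemma sum_card_crossing (F : SimpleGraph V) (S : Finset V) :
    ∑ v, (crossing F S v).card = 2 * ∑ v ∈ S, (crossing F S v).card := by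
  have h := Finset.sum_card_bipartiteAbove_eq_sum_card_bipartiteBelow (s := S) (t := Sᶜ) F.Adj
  have h1 : ∑ v ∈ S, (crossing F S v).card
      = ∑ v ∈ S, (Finset.bipartiteAbove F.Adj Sᶜ v).card := by
    refine Finset.sum_congr rfl fun v hv => ?_
    congr 1
    ext u
    simp only [crossing, Finset.bipartiteAbove, Finset.mem_filter, Finset.mem_univ, true_and,
      Finset.mem_compl]
    tauto
  have h2 : ∑ v ∈ Sᶜ, (crossing F S v).card
      = ∑ v ∈ Sᶜ, (Finset.bipartiteBelow F.Adj S v).card := by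
    refine Finset.sum_congr rfl fun v hv => ?_
    congr 1
    ext u
    simp only [crossing, Finset.bipartiteBelow, Finset.mem_filter, Finset.mem_univ, true_and]
    rw [Finset.mem_compl] at hv
    have := F.adj_comm u v
    tauto
  rw [← Finset.sum_add_sum_compl S, h2, ← h, ← h1, two_mul]

lemma sum_card_nbrs_cutDelete (F : SimpleGraph V) (S : Finset V) :
    ∑ v, (nbrs F v).card
      = ∑ v, (nbrs (cutDelete F S) v).card + 2 * ∑ v ∈ S, (crossing F S v).card := by
  rw [← sum_card_crossing, ← Finset.sum_add_distrib]
  exact Finset.sum_congr rfl fun v _ => (card_nbrs_cutDelete F S v).symm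

lemma comp_mono {F F' : SimpleGraph V} (h : F ≤ F') (v : V) : comp F v ⊆ comp F' v := by
  intro u hu
  simp only [comp, Finset.mem_filter, Finset.mem_univ, true_and] at hu ⊢
  exact hu.mono h

lemma comp_cutDelete_subset (F : SimpleGraph V) (S : Finset V) {v : V} (hv : v ∈ S) :
    comp (cutDelete F S) v ⊆ S := by
  intro u hu
  simp only [comp, Finset.mem_filter, Finset.mem_univ, true_and] at hu
  exact reachable_induction (P := (· ∈ S)) (fun a b (hab : (cutDelete F S).Adj a b) ha =>
    hab.2.1 ha) hu hv

/-- The sum over the vertices of the binary logarithm of the size of their component. -/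
noncomputable def logPotential (F : SimpleGraph V) : ℕ := ∑ v, Nat.log 2 (comp F v).card

lemma logPotential_le (F : SimpleGraph V) :
    logPotential F ≤ Fintype.card V * Nat.log 2 (Fintype.card V) := by
  unfold logPotential
  rw [← smul_eq_mul, ← Finset.card_univ, ← Finset.sum_const]
  exact Finset.sum_le_sum fun v _ => Nat.log_mono_right (Finset.card_le_univ _)

/-- Every vertex of the smaller side sees its component at least halve, so its logarithm drops by at
least one. -/
lemma logPotential_cutDelete (F : SimpleGraph V) (S : Finset V) {a : V} (hS : S ⊆ comp F a)
    (hcard : 2 * S.card ≤ (comp F a).card) :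
    logPotential (cutDelete F S) + S.card ≤ logPotential F := by
  unfold logPotential
  rw [Finset.card_eq_sum_ones, ← Finset.sum_add_sum_compl S, ← Finset.sum_add_sum_compl S
    (fun v => Nat.log 2 (comp F v).card), add_right_comm, ← Finset.sum_add_distrib]
  refine add_le_add (Finset.sum_le_sum fun v hv => ?_) (Finset.sum_le_sum fun v _ => ?_)
  · have h1 : (comp (cutDelete F S) v).card ≤ S.card :=
      Finset.card_le_card (comp_cutDelete_subset F S hv)
    have h2 : comp F v = comp F a := by
      have hav : F.Reachable a v := by simpa [comp] using hS hv
      ext u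
      simp only [comp, Finset.mem_filter, Finset.mem_univ, true_and]
      exact ⟨hav.trans, hav.symm.trans⟩
    have h3 : S.card ≠ 0 := Finset.card_ne_zero_of_mem hv
    rw [h2]
    calc Nat.log 2 (comp (cutDelete F S) v).card + 1 ≤ Nat.log 2 S.card + 1 := by
          gcongr
      _ = Nat.log 2 (S.card * 2) := (Nat.log_mul_base (by norm_num) h3).symm
      _ ≤ _ := Nat.log_mono_right (by omega)
  · exact Nat.log_mono_right (Finset.card_le_card (comp_mono (cutDelete_le F S) v))

/-- The budget maintained while edges are deleted from `Γ`: deletions are paid for by the drop of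
the potential and by the degrees of the isolated vertices. -/
def DeletionBudget (Γ F : SimpleGraph V) : Prop :=
  5 * ∑ v, (nbrs Γ v).card + 10 * logPotential F ≤
    10 * (Fintype.card V * Nat.log 2 (Fintype.card V)) + 5 * ∑ v, (nbrs F v).card
      + 2 * ∑ v, if (nbrs F v).card = 0 then (nbrs Γ v).card else 0

lemma card_nbrs_mono {F F' : SimpleGraph V} (h : F ≤ F') (v : V) :
    (nbrs F v).card ≤ (nbrs F' v).card := by
  apply Finset.card_le_card
  intro u hu
  simp only [nbrs, Finset.mem_filter, Finset.mem_univ, true_and] at hu ⊢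
  exact h hu

lemma isolated_sum_mono (Γ : SimpleGraph V) {F F' : SimpleGraph V} (h : F' ≤ F) :
    (∑ v, if (nbrs F v).card = 0 then (nbrs Γ v).card else 0)
      ≤ ∑ v, if (nbrs F' v).card = 0 then (nbrs Γ v).card else 0 := by
  refine Finset.sum_le_sum fun v _ => ?_
  have := card_nbrs_mono h v
  split_ifs <;> omega

/-- The degree sum loses at most `2 * S.card`, which weighs 10 per vertex of `S`; this is exactly
what the potential gives back. -/
lemma DeletionBudget.cut {Γ F : SimpleGraph V} (h : DeletionBudget Γ F) (S : Finset V) {a : V}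
    (hS : S ⊆ comp F a) (hcard : 2 * S.card ≤ (comp F a).card)
    (hx : ∑ v ∈ S, (crossing F S v).card ≤ S.card) : DeletionBudget Γ (cutDelete F S) := by
  unfold DeletionBudget at *
  have h1 := logPotential_cutDelete F S hS hcard
  have h2 := sum_card_nbrs_cutDelete F S
  have h3 := isolated_sum_mono Γ (cutDelete_le F S)
  omega

lemma crossing_singleton (F : SimpleGraph V) (v : V) : crossing F {v} v = nbrs F v := by
  ext u
  simp only [crossing, nbrs, Finset.mem_filter, Finset.mem_univ, true_and, Finset.mem_singleton]
  refine ⟨fun h => h.1, fun h => ⟨h, ?_⟩⟩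
  have := h.ne'
  tauto

lemma logPotential_mono {F F' : SimpleGraph V} (h : F ≤ F') :
    logPotential F ≤ logPotential F' :=
  Finset.sum_le_sum fun v _ => Nat.log_mono_right (Finset.card_le_card (comp_mono h v))

/-- The degree sum loses twice the degree of `v` in `F`, weighing ten times that degree. The newly
isolated `v` contributes twice its degree in `Γ`, which is at least as much. -/
lemma DeletionBudget.isolate {Γ F : SimpleGraph V} (h : DeletionBudget Γ F) (v : V)
    (hv : (nbrs F v).card ≠ 0) (hd : 5 * (nbrs F v).card ≤ (nbrs Γ v).card) :
    DeletionBudget Γ (cutDelete F {v}) := by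
  unfold DeletionBudget at *
  have h1 := logPotential_mono (cutDelete_le F {v})
  have h2 := sum_card_nbrs_cutDelete F {v}
  rw [Finset.sum_singleton, crossing_singleton] at h2
  have h4 := card_nbrs_cutDelete F {v} v
  rw [crossing_singleton] at h4
  have h3 : (∑ w, if (nbrs F w).card = 0 then (nbrs Γ w).card else 0) + (nbrs Γ v).card
      ≤ ∑ w, if (nbrs (cutDelete F {v}) w).card = 0 then (nbrs Γ w).card else 0 := by
    rw [← Finset.add_sum_erase _ _ (Finset.mem_univ v), ← Finset.add_sum_erase
      (a := v) (f := fun w => if (nbrs (cutDelete F {v}) w).card = 0 then (nbrs Γ w).card else 0)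
      _ (Finset.mem_univ v), if_neg hv, if_pos (by omega), zero_add, add_comm]
    gcongr with w
    have := card_nbrs_mono (cutDelete_le F {v}) w
    split_ifs <;> omega
  omega

lemma card_crossing_ge (F : SimpleGraph V) (S : Finset V) {v : V} (hv : v ∈ S) :
    (nbrs F v).card ≤ (crossing F S v).card + S.card := by
  refine (Finset.card_le_card ?_).trans (Finset.card_union_le _ _)
  intro u hu
  simp only [nbrs, crossing, Finset.mem_union, Finset.mem_filter, Finset.mem_univ,
    true_and] at hu ⊢
  tauto

/-- Every graph `Γ` has a subgraph `F` missing only `O(n log n)` edges such that every cut crossed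
by an edge of `F` is crossed by at least a constant weight, when the edges at a vertex share a unit
weight equally. -/
theorem exists_wellConnected_subgraph (Γ : SimpleGraph V) :
    ∃ F ≤ Γ, (∑ v, (nbrs Γ v).card
        ≤ ∑ v, (nbrs F v).card + 4 * (Fintype.card V * Nat.log 2 (Fintype.card V))) ∧
      ∀ S : Finset V, (∃ a b, F.Adj a b ∧ a ∈ S ∧ b ∉ S) →
        (1 / 10 : ℝ) ≤ ∑ v, ((crossing F S v).card : ℝ) / (nbrs Γ v).card := by
  have hne : ({F | F ≤ Γ ∧ DeletionBudget Γ F} : Set (SimpleGraph V)).Nonempty := by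
    refine ⟨Γ, le_rfl, ?_⟩
    have := logPotential_le Γ
    unfold DeletionBudget
    omega
  obtain ⟨F, hF⟩ := (Set.toFinite _).exists_minimal hne
  have hFΓ : F ≤ Γ := hF.prop.1
  have hbud : DeletionBudget Γ F := hF.prop.2
  -- no deletion step applies to a minimal `F`
  have hmin : ∀ S : Finset V, DeletionBudget Γ (cutDelete F S) →
      ∀ a b, F.Adj a b → a ∈ S → b ∈ S := by
    intro S hS a b hab ha
    have hle : F ≤ cutDelete F S :=
      hF.le_of_le ⟨(cutDelete_le F S).trans hFΓ, hS⟩ (cutDelete_le F S)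
    exact (hle hab).2.1 ha
  refine ⟨F, hFΓ, ?_, ?_⟩
  -- Isolated vertices are charged only for edges missing from `F`. With D the number of missing
  -- edges, counted at both ends, the budget gives 5D ≤ 10 n log n + 2D, so D ≤ (10/3) n log n.
  · have h1 : (∑ v, if (nbrs F v).card = 0 then (nbrs Γ v).card else 0) + ∑ v, (nbrs F v).card
        ≤ ∑ v, (nbrs Γ v).card := by
      rw [← Finset.sum_add_distrib]
      refine Finset.sum_le_sum fun v _ => ?_
      have := card_nbrs_mono hFΓ v
      split_ifs <;> omega
    unfold DeletionBudget at hbud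
    omega
  · have hdeg : ∀ v, (nbrs F v).card ≠ 0 → (nbrs Γ v).card ≤ 5 * (nbrs F v).card := by
      intro v hv
      by_contra hlt
      obtain ⟨u, hu⟩ := Finset.card_ne_zero.1 hv
      have hvu : F.Adj v u := by simpa [nbrs] using hu
      have := hmin {v} (hbud.isolate v hv (by omega)) v u hvu (by simp)
      exact hvu.ne' (by simpa using this)
    rintro S ⟨a, b, hab, ha, hb⟩
    -- the smaller side of the cut inside the component of `a`
    obtain ⟨S', hS'X, hS'card, hS'cross, x, y, hxy, hx, hy⟩ : ∃ S' ⊆ comp F a,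
        2 * S'.card ≤ (comp F a).card ∧ (∀ v ∈ S', crossing F S' v ⊆ crossing F S v) ∧
        ∃ x y, F.Adj x y ∧ x ∈ S' ∧ y ∉ S' := by
      have hsplit := Finset.card_filter_add_card_filter_not (s := comp F a) (· ∈ S)
      have hmem : ∀ v u, v ∈ comp F a → F.Adj v u → u ∈ comp F a := by
        intro v u hv huv
        simp only [comp, Finset.mem_filter, Finset.mem_univ, true_and] at hv ⊢
        exact hv.trans huv.reachable
      have haX : a ∈ comp F a := by simp [comp]
      have hbX : b ∈ comp F a := hmem a b haX hab
      by_cases hle : ((comp F a).filter (· ∈ S)).card ≤ ((comp F a).filter (· ∉ S)).card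
      · refine ⟨(comp F a).filter (· ∈ S), Finset.filter_subset _ _, by omega, ?_, a, b, hab,
          by simp [haX, ha], by simp [hb]⟩
        intro v hv u hu
        simp only [crossing, Finset.mem_filter, Finset.mem_univ, true_and] at hu hv ⊢
        have := hmem v u hv.1 hu.1
        tauto
      · refine ⟨(comp F a).filter (· ∉ S), Finset.filter_subset _ _, by omega, ?_, b, a, hab.symm,
          by simp [hbX, hb], by simp [ha]⟩
        intro v hv u hu
        simp only [crossing, Finset.mem_filter, Finset.mem_univ, true_and] at hu hv ⊢
        have := hmem v u hv.1 hu.1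
        tauto
    have hsum : ∑ v ∈ S', ((crossing F S' v).card : ℝ) / (nbrs Γ v).card
        ≤ ∑ v, ((crossing F S v).card : ℝ) / (nbrs Γ v).card := by
      calc _ ≤ ∑ v ∈ S', ((crossing F S v).card : ℝ) / (nbrs Γ v).card := by
            refine Finset.sum_le_sum fun v hv => ?_
            gcongr
            exact hS'cross v hv
        _ ≤ _ := Finset.sum_le_sum_of_subset_of_nonneg (Finset.subset_univ _)
            fun _ _ _ => by positivity
    refine le_trans ?_ hsum
    -- A vertex of degree at least `2 * S'.card` has at least half its `F`-edges leaving `S'`, hence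
    -- a tenth of its `Γ`-degree: this vertex alone supplies the weight. Otherwise all relevant
    -- `Γ`-degrees are at most `10 * S'.card`, and minimality forces more than `S'.card` crossing
    -- edges.
    by_cases hbig : ∃ v ∈ S', 2 * S'.card ≤ (nbrs F v).card
    · obtain ⟨v, hv, hvbig⟩ := hbig
      have hpos : 0 < S'.card := Finset.card_pos.2 ⟨v, hv⟩
      have h1 := card_crossing_ge F S' hv
      have h2 := hdeg v (by omega)
      have h3 := card_nbrs_mono hFΓ v
      have h4 : (nbrs Γ v).card ≤ 10 * (crossing F S' v).card := by omega
      have h5 : (0 : ℝ) < (nbrs Γ v).card := by exact_mod_cast (by omega : 0 < (nbrs Γ v).card)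
      refine le_trans ?_ (Finset.single_le_sum (f := fun v =>
        ((crossing F S' v).card : ℝ) / (nbrs Γ v).card) (fun _ _ => by positivity) hv)
      rw [div_le_div_iff₀ (by norm_num) h5]
      have : ((nbrs Γ v).card : ℝ) ≤ 10 * (crossing F S' v).card := by exact_mod_cast h4
      linarith
    · push Not at hbig
      have hx' : S'.card < ∑ v ∈ S', (crossing F S' v).card := by
        by_contra hle
        exact hy (hmin S' (hbud.cut S' hS'X hS'card (by omega)) x y hxy hx)
      have hpos : (0 : ℝ) < S'.card := by exact_mod_cast Finset.card_pos.2 ⟨x, hx⟩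
      have h1 : ∑ v ∈ S', ((crossing F S' v).card : ℝ) / (10 * S'.card)
          ≤ ∑ v ∈ S', ((crossing F S' v).card : ℝ) / (nbrs Γ v).card := by
        refine Finset.sum_le_sum fun v hv => ?_
        by_cases h0 : (crossing F S' v).card = 0
        · simp [h0]
        · have h4 := card_nbrs_cutDelete F S' v
          have h2 := hdeg v (by omega)
          have h3 := card_nbrs_mono hFΓ v
          have h5 := hbig v hv
          have h6 : (nbrs Γ v).card ≤ 10 * S'.card := by omega
          apply div_le_div_of_nonneg_left (by positivity)
          · exact_mod_cast (by omega : 0 < (nbrs Γ v).card)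
          · exact_mod_cast h6
      refine le_trans ?_ h1
      rw [← Finset.sum_div, div_le_div_iff₀ (by norm_num) (by positivity)]
      have : (S'.card : ℝ) ≤ ∑ v ∈ S', ((crossing F S' v).card : ℝ) := by exact_mod_cast hx'.le
      linarith

end Decomposition

/-! ### Contraction of components by random stages -/

section Contraction

open scoped Classical

variable {V : Type} [Fintype V]

/-- The components of `H` that an edge of `F` leaves. -/
noncomputable def openComps (F H : SimpleGraph V) : Finset (Finset V) :=
  (Finset.univ.image (comp H)).filter fun S => ∃ a b, F.Adj a b ∧ a ∈ S ∧ b ∉ S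

/-- A common edge of `F` and `M` leaves `S`. -/
def Hits (F M : SimpleGraph V) (S : Finset V) : Prop :=
  ∃ v u, F.Adj v u ∧ M.Adj v u ∧ v ∈ S ∧ u ∉ S

lemma mem_comp {H : SimpleGraph V} {u v : V} : u ∈ comp H v ↔ H.Reachable v u := by
  simp [comp]

lemma comp_eq_of_reachable {H : SimpleGraph V} {u v : V} (h : H.Reachable u v) :
    comp H u = comp H v := by
  ext w
  rw [mem_comp, mem_comp]
  exact ⟨h.symm.trans, h.trans⟩

lemma comp_mem_openComps {F H : SimpleGraph V} {a b : V} (hab : F.Adj a b)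
    (h : ¬ H.Reachable a b) : comp H a ∈ openComps F H :=
  Finset.mem_filter.2 ⟨Finset.mem_image_of_mem _ (Finset.mem_univ _), a, b, hab,
    mem_comp.2 .rfl, fun hb => h (mem_comp.1 hb)⟩

/-- A charging argument: a new open component contains either an old one that is not hit, of weight
1, or a hit one together with the distinct open component it merges with, of weight at least 1/2
each. Each old component is charged at most once. -/
lemma card_openComps_sup_le (F H M : SimpleGraph V) :
    ((openComps F (H ⊔ M)).card : ℝ)
      ≤ ∑ S ∈ openComps F H, if Hits F M S then (1 / 2 : ℝ) else 1 := by
  set wt : Finset V → ℝ := fun S => if Hits F M S then (1 / 2 : ℝ) else 1 with hwt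
  have hwt0 : ∀ S, 1 / 2 ≤ wt S := by intro S; simp only [hwt]; split_ifs <;> norm_num
  have hwt1 : ∀ S, 0 ≤ wt S := fun S => by linarith [hwt0 S]
  have key : ∀ S' ∈ openComps F (H ⊔ M),
      (1 : ℝ) ≤ ∑ S ∈ (openComps F H).filter (· ⊆ S'), wt S := by
    intro S' hS'
    obtain ⟨hS'c, a, b, hab, ha, hb⟩ := Finset.mem_filter.1 hS'
    obtain ⟨x, -, rfl⟩ := Finset.mem_image.1 hS'c
    have hax : comp (H ⊔ M) x = comp (H ⊔ M) a := comp_eq_of_reachable (mem_comp.1 ha)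
    rw [hax] at hb ⊢
    have hHa : comp H a ⊆ comp (H ⊔ M) a := comp_mono le_sup_left a
    have hSa : comp H a ∈ (openComps F H).filter (· ⊆ comp (H ⊔ M) a) :=
      Finset.mem_filter.2 ⟨comp_mem_openComps hab fun h => hb (hHa (mem_comp.2 h)), hHa⟩
    by_cases hit : Hits F M (comp H a)
    · obtain ⟨v, u, hF, hM, hv, hu⟩ := hit
      have hau : (H ⊔ M).Reachable a u :=
        (mem_comp.1 (hHa hv)).trans (SimpleGraph.Adj.reachable (Or.inr hM))
      have hSu : comp H u ∈ (openComps F H).filter (· ⊆ comp (H ⊔ M) a) := by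
        refine Finset.mem_filter.2 ⟨comp_mem_openComps hF.symm fun h => hu ?_, ?_⟩
        · exact mem_comp.2 ((mem_comp.1 hv).trans h.symm)
        · rw [comp_eq_of_reachable hau]
          exact comp_mono le_sup_left u
      have hne : comp H a ≠ comp H u := fun h => hu (h ▸ mem_comp.2 .rfl)
      have := Finset.sum_le_sum_of_subset_of_nonneg (f := wt)
        (Finset.insert_subset hSa (Finset.singleton_subset_iff.2 hSu)) fun S _ _ => hwt1 S
      rw [Finset.sum_pair hne] at this
      linarith [hwt0 (comp H a), hwt0 (comp H u)]
    · refine le_trans ?_ (Finset.single_le_sum (fun S _ => hwt1 S) hSa)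
      simp [hwt, hit]
  calc ((openComps F (H ⊔ M)).card : ℝ) = ∑ _S' ∈ openComps F (H ⊔ M), (1 : ℝ) := by simp
    _ ≤ ∑ S' ∈ openComps F (H ⊔ M), ∑ S ∈ (openComps F H).filter (· ⊆ S'), wt S :=
        Finset.sum_le_sum key
    _ = ∑ S ∈ openComps F H, ∑ S' ∈ (openComps F (H ⊔ M)).filter (S ⊆ ·), wt S := by
        simp only [Finset.sum_filter]
        exact Finset.sum_comm
    _ ≤ ∑ S ∈ openComps F H, wt S := by
        refine Finset.sum_le_sum fun S hS => ?_
        rw [Finset.sum_const, nsmul_eq_mul]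
        refine mul_le_of_le_one_left (hwt1 S) ?_
        suffices h : ((openComps F (H ⊔ M)).filter (S ⊆ ·)).card ≤ 1 by exact_mod_cast h
        obtain ⟨a, _, _, ha, _⟩ := (Finset.mem_filter.1 hS).2
        have huniq : ∀ S' ∈ (openComps F (H ⊔ M)).filter (S ⊆ ·), S' = comp (H ⊔ M) a := by
          intro S' hS'
          obtain ⟨h1, h2⟩ := Finset.mem_filter.1 hS'
          obtain ⟨x, -, rfl⟩ := Finset.mem_image.1 (Finset.mem_filter.1 h1).1
          exact comp_eq_of_reachable (mem_comp.1 (h2 ha))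
        exact Finset.card_le_one.2 fun A hA B hB => (huniq A hA).trans (huniq B hB).symm

variable {Ω : Type} [Fintype Ω] [Nonempty Ω]

lemma sum_card_openComps_sup_le (F H : SimpleGraph V) (M : Ω → SimpleGraph V) {δ : ℝ}
    (hM : ∀ S : Finset V, (∃ a b, F.Adj a b ∧ a ∈ S ∧ b ∉ S) → δ ≤ pr fun ω => Hits F (M ω) S) :
    ∑ ω, ((openComps F (H ⊔ M ω)).card : ℝ)
      ≤ Fintype.card Ω * (1 - δ / 2) * (openComps F H).card := by
  have hc : (0 : ℝ) < Fintype.card Ω := by exact_mod_cast Fintype.card_pos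
  calc _ ≤ ∑ ω, ∑ S ∈ openComps F H, (if Hits F (M ω) S then (1 / 2 : ℝ) else 1) :=
        Finset.sum_le_sum fun ω _ => card_openComps_sup_le F H (M ω)
    _ = ∑ S ∈ openComps F H, ∑ ω, (if Hits F (M ω) S then (1 / 2 : ℝ) else 1) :=
        Finset.sum_comm
    _ ≤ ∑ S ∈ openComps F H, Fintype.card Ω * (1 - δ / 2) := by
        refine Finset.sum_le_sum fun S hS => ?_
        have h := hM S (Finset.mem_filter.1 hS).2
        rw [pr_eq_expect, le_div_iff₀ hc] at h
        have h2 : ∑ ω, (if Hits F (M ω) S then (1 / 2 : ℝ) else 1)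
            = Fintype.card Ω - (∑ ω, if Hits F (M ω) S then (1 : ℝ) else 0) / 2 := by
          rw [← Finset.card_univ, Finset.card_eq_sum_ones, Nat.cast_sum, Finset.sum_div,
            ← Finset.sum_sub_distrib]
          refine Finset.sum_congr rfl fun ω _ => ?_
          split_ifs <;> norm_num
        rw [h2]
        linarith
    _ = _ := by rw [Finset.sum_const, nsmul_eq_mul, mul_comm]

/-- The stages are added one at a time. The starting graph `H` is arbitrary because the hitting
hypothesis concerns all cuts, whatever has been contracted before. -/
lemma sum_card_openComps_iSup_le (F : SimpleGraph V) (M : Ω → SimpleGraph V) {δ : ℝ} (hδ : δ ≤ 1)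
    (hM : ∀ S : Finset V, (∃ a b, F.Adj a b ∧ a ∈ S ∧ b ∉ S) → δ ≤ pr fun ω => Hits F (M ω) S)
    (T : ℕ) : ∀ H : SimpleGraph V,
    ∑ ω : Fin T → Ω, ((openComps F (H ⊔ ⨆ i, M (ω i))).card : ℝ)
      ≤ (Fintype.card Ω * (1 - δ / 2)) ^ T * (openComps F H).card := by
  induction T with
  | zero => intro H; simp
  | succ T ih =>
    intro H
    rw [← (Fin.consEquiv fun _ : Fin (T + 1) => Ω).sum_comp, Fintype.sum_prod_type]
    have h : ∀ (x : Ω) (ω : Fin T → Ω), H ⊔ ⨆ i, M ((Fin.consEquiv fun _ : Fin (T + 1) => Ω)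
        (x, ω) i) = (H ⊔ M x) ⊔ ⨆ i, M (ω i) := by
      intro x ω
      ext u v
      simp [Fin.exists_fin_succ, or_assoc]
    simp only [h]
    calc _ ≤ ∑ x, (Fintype.card Ω * (1 - δ / 2)) ^ T * ((openComps F (H ⊔ M x)).card : ℝ) :=
          Finset.sum_le_sum fun x _ => ih (H ⊔ M x)
      _ ≤ (Fintype.card Ω * (1 - δ / 2)) ^ T *
          (Fintype.card Ω * (1 - δ / 2) * (openComps F H).card) := by
          rw [← Finset.mul_sum]
          have : 0 ≤ 1 - δ / 2 := by linarith
          gcongr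
          exact sum_card_openComps_sup_le F H M hM
      _ = _ := by ring

/-- If every cut crossed by `F` is hit with probability at least `δ` in one stage, then after `T`
independent stages all edges of `F` are contracted, except with probability `n (1 - δ/2) ^ T`. -/
theorem pr_not_contracted_le (F : SimpleGraph V) (M : Ω → SimpleGraph V) {δ : ℝ} (hδ : δ ≤ 1)
    (hM : ∀ S : Finset V, (∃ a b, F.Adj a b ∧ a ∈ S ∧ b ∉ S) → δ ≤ pr fun ω => Hits F (M ω) S)
    (T : ℕ) :
    pr (fun ω : Fin T → Ω => ¬ ∀ u v, F.Adj u v → (⨆ i, M (ω i)).Reachable u v)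
      ≤ Fintype.card V * (1 - δ / 2) ^ T := by
  have hc : (0 : ℝ) < Fintype.card Ω := by exact_mod_cast Fintype.card_pos
  have h := sum_card_openComps_iSup_le F M hδ hM T ⊥
  rw [pr_eq_expect, div_le_iff₀ (by exact_mod_cast Fintype.card_pos)]
  have h1 : ((openComps F ⊥).card : ℝ) ≤ Fintype.card V := by
    have : (openComps F ⊥).card ≤ Fintype.card V :=
      (Finset.card_filter_le _ _).trans (Finset.card_image_le.trans (by simp))
    exact_mod_cast this
  have h2 : 0 ≤ 1 - δ / 2 := by linarith
  -- Markov's inequality: if some edge of `F` is not contracted, at least one open component is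
  -- left.
  calc _ ≤ ∑ ω : Fin T → Ω, ((openComps F (⊥ ⊔ ⨆ i, M (ω i))).card : ℝ) := by
        refine Finset.sum_le_sum fun ω _ => ?_
        split_ifs with hω
        · positivity
        · push Not at hω
          obtain ⟨u, v, huv, hnot⟩ := hω
          have := comp_mem_openComps huv hnot
          rw [bot_sup_eq]
          exact_mod_cast Finset.card_pos.2 ⟨_, this⟩
    _ ≤ _ := h
    _ ≤ (Fintype.card Ω * (1 - δ / 2)) ^ T * Fintype.card V := by gcongr
    _ = _ := by
        rw [Fintype.card_fun, Fintype.card_fin, mul_pow]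
        push_cast
        ring

end Contraction

/-! ### Sampling edges at every vertex -/

section StarSampling

open scoped Classical

/-- The event of probability `2 ^ (-j)` under a uniform element of `Fin (2 ^ K)`. -/
def Low {K : ℕ} (j : ℕ) (x : Fin (2 ^ K)) : Prop := x.val < 2 ^ (K - j)

lemma pr_low {K j : ℕ} (hj : j ≤ K) : pr (Low (K := K) j) = 1 / 2 ^ j := by
  have h : (Finset.univ.filter (Low (K := K) j)).card = 2 ^ (K - j) := by
    have := Fin.card_filter_val_lt (n := 2 ^ K) (m := 2 ^ (K - j))
    rw [min_eq_right (Nat.pow_le_pow_right (by norm_num) (Nat.sub_le K j))] at this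
    rw [← this]
    congr
  rw [pr_eq, h, Fintype.card_fin, div_eq_div_iff (by positivity) (by positivity)]
  push_cast
  rw [one_mul, ← pow_add, Nat.sub_add_cancel hj]

variable {V : Type} {Ω : Type} [Fintype Ω]

lemma sum_pr_le_pr_exists (C : Finset V) (E : V → Ω → Prop)
    (h : ∀ ω, ∀ u ∈ C, ∀ w ∈ C, E u ω → E w ω → u = w) :
    ∑ u ∈ C, pr (E u) ≤ pr fun ω => ∃ u ∈ C, E u ω := by
  simp only [pr_eq, ← Finset.sum_div]
  gcongr
  rw [← Nat.cast_sum, ← Finset.card_biUnion]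
  · refine Nat.cast_le.2 (Finset.card_le_card fun ω hω => ?_)
    simpa using hω
  · intro u hu w hw huw
    rw [Function.onFun, Finset.disjoint_filter]
    exact fun ω _ h1 h2 => huw (h ω u hu w hw h1 h2)

/-- `u` is the only neighbour of `v` in the random set described by `ω`. -/
def UniqueSample {K : ℕ} (Γ : SimpleGraph V) (v : V) (ω : Fin (K + 1) × (V → Fin (2 ^ K)))
    (u : V) : Prop :=
  Γ.Adj v u ∧ Low ω.1.val (ω.2 u) ∧ ∀ w, Γ.Adj v w → Low ω.1.val (ω.2 w) → w = u

/-- The graph of the edges found when every vertex samples a random set. -/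
def stageGraph {K : ℕ} (Γ : SimpleGraph V) (ω : V → Fin (K + 1) × (V → Fin (2 ^ K))) :
    SimpleGraph V :=
  SimpleGraph.fromRel fun v u => UniqueSample Γ v (ω v) u

lemma stageGraph_le {K : ℕ} (Γ : SimpleGraph V) (ω : V → Fin (K + 1) × (V → Fin (2 ^ K))) :
    stageGraph Γ ω ≤ Γ := by
  intro u v h
  rcases ((SimpleGraph.fromRel_adj _ _ _).1 h).2 with h | h
  · exact h.1
  · exact h.1.symm

/-- The seed of the first round. -/
abbrev SampleSeed (V : Type) (L T : ℕ) : Type :=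
  Fin T → V → Fin (L + 1 + 1) × (V → Fin (2 ^ (L + 1)))

/-- The graph of the edges found in the first round. -/
def sampledGraph (Γ : SimpleGraph V) {L T : ℕ} (ω : SampleSeed V L T) : SimpleGraph V :=
  ⨆ i, stageGraph Γ (ω i)

lemma sampledGraph_le (Γ : SimpleGraph V) {L T : ℕ} (ω : SampleSeed V L T) :
    sampledGraph Γ ω ≤ Γ := iSup_le fun _ => stageGraph_le _ _

variable [Fintype V]

variable [DecidableEq V]

/-- With d the degree of `v`, the density within a factor 2 of 1/(2d) isolates each given neighbour
with probability at least 1/(8d). These events are disjoint, so they add up over `C`; hitting on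
that density costs the factor 1/(L + 2). -/
lemma pr_uniqueSample_ge {L : ℕ} (hL : Fintype.card V ≤ 2 ^ L) (Γ : SimpleGraph V) (v : V)
    (C : Finset V) (hC : C ⊆ nbrs Γ v) :
    (1 / (8 * (L + 2)) : ℝ) * (C.card / (nbrs Γ v).card)
      ≤ pr fun ω : Fin (L + 1 + 1) × (V → Fin (2 ^ (L + 1))) =>
        ∃ u ∈ C, UniqueSample Γ v ω u := by
  rcases C.eq_empty_or_nonempty with rfl | ⟨u₀, hu₀⟩
  · simpa using pr_nonneg _
  set d := (nbrs Γ v).card with hd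
  have hdpos : 0 < d := Finset.card_pos.2 ⟨u₀, hC hu₀⟩
  have hd2 : d ≤ 2 ^ L := (Finset.card_le_univ _).trans hL
  -- This level satisfies 2d ≤ 2^j < 4d. The first inequality bounds the expected number of sampled
  -- neighbours by 1/2, the second keeps the density above 1/(4d).
  set j := Nat.clog 2 (2 * d) with hj
  have hj1 : 2 * d ≤ 2 ^ j := Nat.le_pow_clog (by norm_num) _
  have hj2 : 2 ^ j < 4 * d := by
    have h1 : 2 ^ (j - 1) < 2 * d := Nat.pow_pred_clog_lt_self (by norm_num) (by omega)
    have h2 : 0 < j := Nat.clog_pos (by norm_num) (by omega)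
    have h3 : 2 ^ j = 2 * 2 ^ (j - 1) := by rw [← pow_succ', Nat.sub_add_cancel h2]
    omega
  have hjK : j ≤ L + 1 := Nat.clog_le_of_le_pow (by rw [pow_succ]; omega)
  have hp := pr_low hjK
  set p : ℝ := pr (Low (K := L + 1) j) with hpdef
  have hp0 : 0 ≤ p := pr_nonneg _
  have hj1' : (2 * d : ℝ) ≤ 2 ^ j := by exact_mod_cast hj1
  have hj2' : (2 : ℝ) ^ j ≤ 4 * d := by exact_mod_cast hj2.le
  have hd' : (0 : ℝ) < d := by exact_mod_cast hdpos
  have hpd : d * p ≤ 1 / 2 := by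
    rw [hp, mul_one_div, div_le_div_iff₀ (by positivity) (by norm_num)]
    linarith
  have hp4 : 1 / (4 * d) ≤ p := by
    rw [hp]
    exact one_div_le_one_div_of_le (by positivity) hj2'
  have hu : ∀ u ∈ C, 1 / (8 * d) ≤ pr fun r : V → Fin (2 ^ (L + 1)) =>
      Γ.Adj v u ∧ Low j (r u) ∧ ∀ w, Γ.Adj v w → Low j (r w) → w = u := by
    intro u hu
    have h := pr_hit_avoid (Low (K := L + 1) j) u ((nbrs Γ v).erase u) (by simp)
    have hvu : Γ.Adj v u := by simpa [nbrs] using hC hu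
    have hcard : ((nbrs Γ v).erase u).card ≤ d := Finset.card_le_card (Finset.erase_subset _ _)
    have h1 := one_sub_mul_le_pow (pr_le_one (Low (K := L + 1) j)) ((nbrs Γ v).erase u).card
    have h2 : (((nbrs Γ v).erase u).card : ℝ) * p ≤ d * p := by gcongr
    have h3 : p * (1 / 2) ≤ p * (1 - p) ^ ((nbrs Γ v).erase u).card := by
      gcongr
      linarith
    have h4 : 1 / (8 * (d : ℝ)) = 1 / (4 * d) * (1 / 2) := by field_simp; norm_num
    rw [← h] at h3
    refine (by linarith : _ ≤ _).trans (h3.trans (pr_mono fun r hr => ⟨hvu, hr.1, ?_⟩))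
    intro w hw hlow
    by_contra hne
    exact hr.2 w (by simp [nbrs, hne, hw]) hlow
  have hsum := sum_pr_le_pr_exists C (fun u (r : V → Fin (2 ^ (L + 1))) =>
      Γ.Adj v u ∧ Low j (r u) ∧ ∀ w, Γ.Adj v w → Low j (r w) → w = u)
    (fun r u _ w _ h1 h2 => h2.2.2 u h1.1 h1.2.1)
  have hC' : (C.card : ℝ) * (1 / (8 * d)) ≤ pr fun r : V → Fin (2 ^ (L + 1)) => ∃ u ∈ C,
      Γ.Adj v u ∧ Low j (r u) ∧ ∀ w, Γ.Adj v w → Low j (r w) → w = u := by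
    refine le_trans ?_ ((Finset.sum_le_sum hu).trans hsum)
    simp
  have hcard : (1 / (8 * (L + 2)) : ℝ) * (C.card / d) = C.card * (1 / (8 * d)) / (L + 2) := by
    field_simp
  have hsingle := Finset.single_le_sum
    (f := fun a : Fin (L + 1 + 1) => pr fun b : V → Fin (2 ^ (L + 1)) =>
      ∃ u ∈ C, UniqueSample Γ v (a, b) u) (fun _ _ => pr_nonneg _)
    (Finset.mem_univ (⟨j, Nat.lt_succ_of_le hjK⟩ : Fin (L + 1 + 1)))
  have hcast : ((Fintype.card (Fin (L + 1 + 1)) : ℕ) : ℝ) = L + 2 := by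
    rw [Fintype.card_fin]
    push_cast
    ring
  rw [pr_prod, hcast, hcard]
  gcongr
  exact hC'.trans hsingle

instance {K : ℕ} : Nonempty (Fin (2 ^ K)) := ⟨⟨0, by positivity⟩⟩

/-- The vertices sample independently and their success probabilities sum to at least x = 1/(80(L +
2)), so all fail with probability at most exp(-x) ≤ 1 - x/2. -/
lemma pr_hits_stageGraph_ge {L : ℕ} (hL : Fintype.card V ≤ 2 ^ L) {Γ F : SimpleGraph V}
    (hF : F ≤ Γ) (S : Finset V)
    (hS : (1 / 10 : ℝ) ≤ ∑ v, ((crossing F S v).card : ℝ) / (nbrs Γ v).card) :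
    1 / (160 * (L + 2)) ≤ pr fun ω : V → Fin (L + 1 + 1) × (V → Fin (2 ^ (L + 1))) =>
      Hits F (stageGraph Γ ω) S := by
  have hsub : ∀ v, crossing F S v ⊆ nbrs Γ v := fun v u hu => by
    simp only [crossing, nbrs, Finset.mem_filter, Finset.mem_univ, true_and] at hu ⊢
    exact hF hu.1
  set q : V → ℝ := fun v => pr fun ω : Fin (L + 1 + 1) × (V → Fin (2 ^ (L + 1))) =>
    ∃ u ∈ crossing F S v, UniqueSample Γ v ω u with hq
  set x : ℝ := 1 / (80 * (L + 2)) with hx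
  have hx0 : 0 ≤ x := by positivity
  have hx1 : x ≤ 1 := by
    rw [hx, div_le_one (by positivity)]
    have : (0 : ℝ) ≤ L := by positivity
    linarith
  have hqx : x ≤ ∑ v, q v := by
    have h1 : (1 / (8 * (L + 2)) : ℝ) * ∑ v, ((crossing F S v).card : ℝ) / (nbrs Γ v).card
        ≤ ∑ v, q v := by
      rw [Finset.mul_sum]
      exact Finset.sum_le_sum fun v _ => pr_uniqueSample_ge hL Γ v _ (hsub v)
    refine le_trans ?_ h1
    calc x = (1 / (8 * (L + 2)) : ℝ) * (1 / 10) := by rw [hx]; field_simp; norm_num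
      _ ≤ _ := by gcongr
  have hfail : pr (fun ω : V → Fin (L + 1 + 1) × (V → Fin (2 ^ (L + 1))) =>
      ¬ ∃ v, ∃ u ∈ crossing F S v, UniqueSample Γ v (ω v) u) ≤ Real.exp (-x) := by
    have h := pr_pi (Ω := Fin (L + 1 + 1) × (V → Fin (2 ^ (L + 1)))) Finset.univ
      fun v ω => ¬ ∃ u ∈ crossing F S v, UniqueSample Γ v ω u
    simp only [pr_not, Finset.mem_univ, true_imp_iff] at h
    simp only [not_exists] at h ⊢
    rw [h]
    calc ∏ v, (1 - q v) ≤ ∏ v, Real.exp (-q v) := by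
          refine Finset.prod_le_prod (fun v _ => ?_) fun v _ => ?_
          · linarith [pr_le_one fun ω : Fin (L + 1 + 1) × (V → Fin (2 ^ (L + 1))) =>
              ∃ u ∈ crossing F S v, UniqueSample Γ v ω u]
          · linarith [Real.add_one_le_exp (-q v)]
      _ = Real.exp (-∑ v, q v) := by rw [← Real.exp_sum, Finset.sum_neg_distrib]
      _ ≤ _ := Real.exp_le_exp.2 (by linarith)
  -- Uses exp(-x) ≤ 1/(1 + x), with x between 0 and 1.
  have hexp : Real.exp (-x) ≤ 1 - x / 2 := by
    have h1 := Real.add_one_le_exp x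
    rw [Real.exp_neg]
    refine (inv_anti₀ (by positivity) h1).trans ?_
    rw [inv_le_iff_one_le_mul₀ (by positivity)]
    nlinarith
  rw [pr_not] at hfail
  have hgoal : 1 / (160 * (L + 2)) = x / 2 := by rw [hx]; field_simp; norm_num
  rw [hgoal]
  refine le_trans (show x / 2 ≤ pr fun ω : V → Fin (L + 1 + 1) × (V → Fin (2 ^ (L + 1))) =>
    ∃ v, ∃ u ∈ crossing F S v, UniqueSample Γ v (ω v) u by linarith) (pr_mono fun ω h => ?_)
  obtain ⟨v, u, hu, hs⟩ := h
  simp only [crossing, Finset.mem_filter, Finset.mem_univ, true_and] at hu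
  have hadj : (stageGraph Γ ω).Adj v u :=
    (SimpleGraph.fromRel_adj _ _ _).2 ⟨hu.1.ne, Or.inl hs⟩
  by_cases hv : v ∈ S
  · exact ⟨v, u, hu.1, hadj, hv, by tauto⟩
  · exact ⟨u, v, hu.1.symm, hadj.symm, by tauto, hv⟩

/-- The neighbours of `v` in `Γ` that lie in another component of `H`. -/
noncomputable def leftover (Γ H : SimpleGraph V) (v : V) : Finset V :=
  Finset.univ.filter fun u => Γ.Adj v u ∧ ¬ H.Reachable v u

/-- After sampling, only `O(n log n)` edges are left between different components. -/
theorem pr_leftover_large_le {L : ℕ} (hL : Fintype.card V < 2 ^ L) (Γ : SimpleGraph V)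
    {T k : ℕ} (hT : T = 320 * (L + 2) * k) :
    pr (fun ω : SampleSeed V L T =>
      ¬ ∑ v, (leftover Γ (sampledGraph Γ ω) v).card ≤ 4 * (Fintype.card V * L))
      ≤ Fintype.card V * ((2 : ℝ) ^ k)⁻¹ := by
  obtain ⟨F, hF, hcard, hcut⟩ := exists_wellConnected_subgraph Γ
  have hδ : (1 / (160 * (L + 2)) : ℝ) ≤ 1 := by
    rw [div_le_one (by positivity)]
    have : (0 : ℝ) ≤ L := by positivity
    linarith
  -- The factor 320(L + 2) in `T` is the reciprocal of the shrinkage per stage, so the exponent is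
  -- exactly -k.
  have hpow : (1 - 1 / (160 * (L + 2)) / 2 : ℝ) ^ T ≤ ((2 : ℝ) ^ k)⁻¹ := by
    refine le_trans ?_ (exp_neg_le_two_pow_inv k)
    have hle : (1 / (160 * (L + 2)) / 2 : ℝ) ≤ 1 := by linarith
    refine (pow_one_sub_le_exp hle _).trans (Real.exp_le_exp.2 (le_of_eq ?_))
    rw [hT]
    push_cast
    field_simp
    ring
  have hcontr := pr_not_contracted_le F (fun ω => stageGraph (K := L + 1) Γ ω) hδ
    (fun S hS => pr_hits_stageGraph_ge hL.le hF S (hcut S hS)) T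
  have himp : ∀ ω : SampleSeed V L T,
      (∀ u v, F.Adj u v → (⨆ i, stageGraph Γ (ω i)).Reachable u v) →
      ∑ v, (leftover Γ (sampledGraph Γ ω) v).card ≤ 4 * (Fintype.card V * L) := by
    intro ω hcon
    have hlog : Nat.log 2 (Fintype.card V) ≤ L := by
      by_cases h0 : Fintype.card V = 0
      · simp [h0]
      · exact (Nat.log_lt_of_lt_pow h0 hL).le
    have hle : ∀ v, (leftover Γ (sampledGraph Γ ω) v).card + (nbrs F v).card
        ≤ (nbrs Γ v).card := by
      intro v
      rw [← Finset.card_union_of_disjoint]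
      · refine Finset.card_le_card fun u hu => ?_
        simp only [leftover, nbrs, Finset.mem_union, Finset.mem_filter, Finset.mem_univ,
          true_and] at hu ⊢
        exact hu.elim (fun h => h.1) fun h => hF h
      · rw [leftover, nbrs, Finset.disjoint_filter]
        exact fun u _ h1 h2 => h1.2 (hcon v u h2)
    have hs := Finset.sum_le_sum fun v (_ : v ∈ Finset.univ) => hle v
    rw [Finset.sum_add_distrib] at hs
    have : Fintype.card V * Nat.log 2 (Fintype.card V) ≤ Fintype.card V * L := by gcongr
    omega
  have hmono : pr (fun ω : SampleSeed V L T =>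
      ¬ ∑ v, (leftover Γ (sampledGraph Γ ω) v).card ≤ 4 * (Fintype.card V * L)) ≤
      pr (fun ω : SampleSeed V L T =>
        ¬ ∀ u v, F.Adj u v → (⨆ i, stageGraph Γ (ω i)).Reachable u v) :=
    pr_mono fun ω hω hcon => hω (himp ω hcon)
  exact hmono.trans (hcontr.trans (mul_le_mul_of_nonneg_left hpow (Nat.cast_nonneg _)))

end StarSampling

/-! ### Group testing and size estimation -/

section GroupTesting

open scoped Classical

variable {U Ω I : Type} [Fintype U] [Fintype Ω] [Nonempty Ω] [Fintype I]
  [DecidableEq U] [DecidableEq I]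

/-- If each of the tests in `J` contains every item independently with probability `pr A`, then
every item outside `D` is in a test that avoids `D`, with high probability. -/
theorem pr_groupTest_fail_le (A : Ω → Prop) (D : Finset U) (hD : D.card * pr A ≤ 1 / 2)
    (J : Finset I) {k : ℕ} (hk : k ≤ J.card * (pr A / 2)) :
    pr (fun ρ : I → U → Ω => ¬ ∀ e ∉ D, ∃ i ∈ J, A (ρ i e) ∧ ∀ e' ∈ D, ¬ A (ρ i e'))
      ≤ Fintype.card U * ((2 : ℝ) ^ k)⁻¹ := by
  have hp0 := pr_nonneg A
  have hitem : ∀ e : U, pr (fun ρ : I → U → Ω =>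
      e ∉ D ∧ ∀ i ∈ J, ¬ (A (ρ i e) ∧ ∀ e' ∈ D, ¬ A (ρ i e'))) ≤ ((2 : ℝ) ^ k)⁻¹ := by
    intro e
    by_cases he : e ∈ D
    · have : pr (fun ρ : I → U → Ω =>
          e ∉ D ∧ ∀ i ∈ J, ¬ (A (ρ i e) ∧ ∀ e' ∈ D, ¬ A (ρ i e'))) = 0 := by simp [pr, he]
      rw [this]
      positivity
    · have h1 := pr_hit_avoid A e D he
      have h2 := one_sub_mul_le_pow (pr_le_one A) D.card
      -- By Bernoulli's inequality a test avoids `D` with probability at least 1/2, so it clears a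
      -- fixed item outside `D` with probability at least half the density.
      have h3 : pr A / 2 ≤ pr A * (1 - pr A) ^ D.card := by
        have : pr A * (1 / 2) ≤ pr A * (1 - pr A) ^ D.card := by
          apply mul_le_mul_of_nonneg_left _ hp0
          linarith
        linarith
      have h4 : pr (fun ρ : I → U → Ω =>
          e ∉ D ∧ ∀ i ∈ J, ¬ (A (ρ i e) ∧ ∀ e' ∈ D, ¬ A (ρ i e')))
          = (1 - pr A * (1 - pr A) ^ D.card) ^ J.card := by
        rw [← h1, ← pr_not, ← Finset.prod_const, ← pr_pi]
        simp only [he, not_false_eq_true, true_and]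
      rw [h4]
      have h5 : pr A * (1 - pr A) ^ D.card ≤ 1 := h1 ▸ pr_le_one _
      calc _ ≤ (1 - pr A / 2) ^ J.card := by
            apply pow_le_pow_left₀ <;> linarith
        _ ≤ Real.exp (-(J.card * (pr A / 2))) :=
            pow_one_sub_le_exp (by linarith [pr_le_one A]) _
        _ ≤ Real.exp (-k) := Real.exp_le_exp.2 (by linarith)
        _ ≤ _ := exp_neg_le_two_pow_inv k
  refine le_trans (pr_mono fun ρ hρ => ?_) (pr_exists_le_of_forall_le _ hitem)
  push Not at hρ
  obtain ⟨e, he, h⟩ := hρ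
  refine ⟨e, he, fun i hi hcon => ?_⟩
  obtain ⟨e', he', h'⟩ := h i hi hcon.1
  exact hcon.2 e' he' h'

/-- Testing random subsets of density `2 ^ (-j)` for `j < L + 2` estimates the size of `D`: a negative
test at level `j` certifies `D.card ≤ 2 ^ j * 2 ^ s`, and some negative test occurs at a level with
`2 ^ j ≤ 4 * D.card + 1`. -/
theorem pr_sizeEstimate_fail_le {K L s ℓ : ℕ} (hK : L + 1 ≤ K) (hs : ℓ ≤ 2 ^ s) (D : Finset U)
    (hD : D.card ≤ 2 ^ L) :
    pr (fun ρ : Fin (L + 2) → Fin ℓ → U → Fin (2 ^ K) => ¬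
      ((∀ j i, (∀ u ∈ D, ¬ Low j.val (ρ j i u)) → D.card ≤ 2 ^ j.val * 2 ^ s) ∧
        ∃ j i, (∀ u ∈ D, ¬ Low j.val (ρ j i u)) ∧ 2 ^ j.val ≤ 4 * D.card + 1))
      ≤ ((L + 2) * ℓ + 1) * ((2 : ℝ) ^ ℓ)⁻¹ := by
  -- a negative test at a level that is too low
  have h1 : pr (fun ρ : Fin (L + 2) → Fin ℓ → U → Fin (2 ^ K) => ∃ x : Fin (L + 2) × Fin ℓ,
      (∀ u ∈ D, ¬ Low x.1.val (ρ x.1 x.2 u)) ∧ 2 ^ x.1.val * 2 ^ s < D.card)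
      ≤ ((L + 2) * ℓ) * ((2 : ℝ) ^ ℓ)⁻¹ := by
    have hx : ∀ x : Fin (L + 2) × Fin ℓ,
        pr (fun ρ : Fin (L + 2) → Fin ℓ → U → Fin (2 ^ K) =>
          (∀ u ∈ D, ¬ Low x.1.val (ρ x.1 x.2 u)) ∧ 2 ^ x.1.val * 2 ^ s < D.card)
          ≤ ((2 : ℝ) ^ ℓ)⁻¹ := by
      rintro ⟨j, i⟩
      by_cases hlt : 2 ^ j.val * 2 ^ s < D.card
      · simp only [hlt, and_true]
        rw [pr_coord j fun r : Fin ℓ → U → Fin (2 ^ K) => ∀ u ∈ D, ¬ Low j.val (r i u),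
          pr_coord i fun r : U → Fin (2 ^ K) => ∀ u ∈ D, ¬ Low j.val (r u), pr_avoid]
        -- Here the expected number of sampled elements of `D` is at least 2^s ≥ ℓ, so even one
        -- negative test has probability at most exp(-ℓ).
        refine (pow_one_sub_le_exp (pr_le_one _) _).trans
          (le_trans (Real.exp_le_exp.2 ?_) (exp_neg_le_two_pow_inv ℓ))
        rw [pr_low (by omega), mul_one_div, neg_le_neg_iff, le_div_iff₀ (by positivity)]
        have : ℓ * 2 ^ j.val ≤ D.card := by
          calc ℓ * 2 ^ j.val ≤ 2 ^ s * 2 ^ j.val := by gcongr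
            _ ≤ D.card := by rw [mul_comm]; exact hlt.le
        exact_mod_cast this
      · have : pr (fun ρ : Fin (L + 2) → Fin ℓ → U → Fin (2 ^ K) =>
            (∀ u ∈ D, ¬ Low j.val (ρ j i u)) ∧ 2 ^ j.val * 2 ^ s < D.card) = 0 := by
          simp [pr, hlt]
        rw [this]
        positivity
    refine (pr_exists_le_of_forall_le _ hx).trans (le_of_eq ?_)
    simp
  -- only positive tests at the right level
  set j₁ := Nat.clog 2 (2 * D.card) with hj₁
  have hj1 : 2 * D.card ≤ 2 ^ j₁ := Nat.le_pow_clog (by norm_num) _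
  have hjL : j₁ ≤ L + 1 := Nat.clog_le_of_le_pow (by rw [pow_succ]; omega)
  have hj2 : 2 ^ j₁ ≤ 4 * D.card + 1 := by
    -- For empty `D` the level is 0, which is why the bound needs the extra 1.
    by_cases h0 : D.card = 0
    · simp [hj₁, h0]
    · have h1 : 2 ^ (j₁ - 1) < 2 * D.card := Nat.pow_pred_clog_lt_self (by norm_num) (by omega)
      have h2 : 0 < j₁ := Nat.clog_pos (by norm_num) (by omega)
      have h3 : 2 ^ j₁ = 2 * 2 ^ (j₁ - 1) := by rw [← pow_succ', Nat.sub_add_cancel h2]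
      omega
  let j : Fin (L + 2) := ⟨j₁, by omega⟩
  have h2 : pr (fun ρ : Fin (L + 2) → Fin ℓ → U → Fin (2 ^ K) =>
      ∀ i ∈ (Finset.univ : Finset (Fin ℓ)), ¬ ∀ u ∈ D, ¬ Low j₁ (ρ j i u))
      ≤ ((2 : ℝ) ^ ℓ)⁻¹ := by
    rw [pr_coord j fun r : Fin ℓ → U → Fin (2 ^ K) =>
      ∀ i ∈ (Finset.univ : Finset (Fin ℓ)), ¬ ∀ u ∈ D, ¬ Low j₁ (r i u)]
    rw [pr_pi Finset.univ fun _ (r : U → Fin (2 ^ K)) => ¬ ∀ u ∈ D, ¬ Low j₁ (r u), pr_not,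
      pr_avoid, Finset.prod_const, Finset.card_univ, Fintype.card_fin, ← inv_pow]
    have hp := pr_low (K := K) (j := j₁) (by omega)
    have hb := one_sub_mul_le_pow (pr_le_one (Low (K := K) j₁)) D.card
    have hhalf : (D.card : ℝ) * pr (Low (K := K) j₁) ≤ 1 / 2 := by
      rw [hp, mul_one_div, div_le_div_iff₀ (by positivity) (by norm_num)]
      have : (2 * D.card : ℝ) ≤ 2 ^ j₁ := by exact_mod_cast hj1
      linarith
    have hle : (1 - pr (Low (K := K) j₁)) ^ D.card ≤ 1 :=
      pow_le_one₀ (by linarith [pr_le_one (Low (K := K) j₁)])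
        (by linarith [pr_nonneg (Low (K := K) j₁)])
    apply pow_le_pow_left₀ <;> linarith
  have hor : pr (fun ρ : Fin (L + 2) → Fin ℓ → U → Fin (2 ^ K) => ∃ b : Bool, if b then
      (∃ x : Fin (L + 2) × Fin ℓ,
        (∀ u ∈ D, ¬ Low x.1.val (ρ x.1 x.2 u)) ∧ 2 ^ x.1.val * 2 ^ s < D.card)
      else ∀ i ∈ (Finset.univ : Finset (Fin ℓ)), ¬ ∀ u ∈ D, ¬ Low j₁ (ρ j i u))
      ≤ ((L + 2) * ℓ + 1) * ((2 : ℝ) ^ ℓ)⁻¹ := by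
    refine (pr_exists_le _).trans ?_
    simp only [Fintype.sum_bool, if_true, Bool.false_eq_true, if_false]
    linarith
  refine le_trans (pr_mono fun ρ hρ => ?_) hor
  by_contra hcon
  simp only [Bool.exists_bool, Bool.false_eq_true, if_false, if_true, not_or] at hcon
  apply hρ
  refine ⟨fun j i hneg => ?_, ?_⟩
  · by_contra hlt
    exact hcon.2 ⟨(j, i), hneg, by simpa using hlt⟩
  · have := hcon.1
    push Not at this
    obtain ⟨i, -, hi⟩ := this
    exact ⟨j, i, hi, hj2⟩

end GroupTesting

/-! ### Rounds, spanning forests and decoding of samples -/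

section Algorithms

open scoped Classical

namespace RoundAlgorithm

variable {Q O : Type}

/-- A round whose queries are indexed by an arbitrary finite type. -/
noncomputable def roundOf {ι : Type} [Fintype ι] {r : ℕ} (query : ι → Q)
    (next : (ι → Bool) → RoundAlgorithm Q O r) : RoundAlgorithm Q O (r + 1) :=
  round (Fintype.card ι) (fun i => query ((Fintype.equivFin ι).symm i))
    fun a => next fun x => a (Fintype.equivFin ι x)

lemma run_roundOf {ι : Type} [Fintype ι] {r : ℕ} (oracle : Q → Bool) (query : ι → Q)
    (next : (ι → Bool) → RoundAlgorithm Q O r) :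
    (roundOf query next).run oracle = (next fun x => oracle (query x)).run oracle := by
  simp [roundOf, run]

lemma numQueries_roundOf {ι : Type} [Fintype ι] {r : ℕ} (oracle : Q → Bool) (query : ι → Q)
    (next : (ι → Bool) → RoundAlgorithm Q O r) :
    (roundOf query next).numQueries oracle
      = Fintype.card ι + (next fun x => oracle (query x)).numQueries oracle := by
  simp [roundOf, numQueries]

/-- The algorithm that returns `o` without asking anything. -/
def idle (o : O) : (r : ℕ) → RoundAlgorithm Q O r
  | 0 => output o
  | r + 1 => round 0 Fin.elim0 fun _ => idle o r

lemma run_idle (oracle : Q → Bool) (o : O) (r : ℕ) : (idle o r).run oracle = o := by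
  induction r with
  | zero => rfl
  | succ r ih => exact ih

lemma numQueries_idle (oracle : Q → Bool) (o : O) (r : ℕ) :
    (idle o r).numQueries oracle = 0 := by
  induction r with
  | zero => rfl
  | succ r ih => simp [idle, numQueries, ih]

end RoundAlgorithm

open RoundAlgorithm

/-- A maximal acyclic subgraph of `K`. -/
noncomputable def forestOf {V : Type} (K : SimpleGraph V) : SimpleGraph V :=
  K.exists_isAcyclic_reachable_eq_le.choose

lemma isSpanningForest_forestOf {n : ℕ} (G : Multigraph n) {K : SimpleGraph (Fin n)}
    (hK : K ≤ G.toSimpleGraph) (h : ∀ u v, G.toSimpleGraph.Adj u v → K.Reachable u v) :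
    G.IsSpanningForest (forestOf K) := by
  obtain ⟨h1, h2, h3⟩ := K.exists_isAcyclic_reachable_eq_le.choose_spec
  refine ⟨le_trans h1 hK, h2, fun u v => ?_⟩
  have h4 : (forestOf K).Reachable u v ↔ K.Reachable u v := by
    unfold forestOf
    rw [h3]
  rw [h4]
  exact ⟨fun huv => huv.mono hK, fun huv => reachable_induction (P := K.Reachable u)
    (fun a b hab ha => ha.trans (h a b hab)) huv .rfl⟩

section FirstRound

variable {n L T : ℕ}

/-- The vertices tested by the first-round query for a stage, a vertex, a bit position and the value
of that bit. -/
noncomputable def sampleSet (ω : SampleSeed (Fin n) L T) (x : Fin T × Fin n × Fin L × Bool) :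
    Finset (Fin n) :=
  Finset.univ.filter fun u => Low (ω x.1 x.2.1).1.val ((ω x.1 x.2.1).2 u) ∧
    u.val.testBit x.2.2.1.val = x.2.2.2

/-- The edges that can be read off from the bitwise answers of the first round. -/
def decodeSample (a : Fin T × Fin n × Fin L × Bool → Bool) : SimpleGraph (Fin n) :=
  SimpleGraph.fromRel fun v u => ∃ t, ∀ b : Fin L,
    a (t, v, b, u.val.testBit b.val) = true ∧ a (t, v, b, !u.val.testBit b.val) = false

/-- If at every bit position only the value belonging to `u` gets a positive answer, all sampled
neighbours of `v` agree with `u` in all `L` bits, hence equal `u`. -/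
lemma decodeSample_eq (hL : 1 ≤ L) (hn : n ≤ 2 ^ L) (Γ : SimpleGraph (Fin n))
    (ω : SampleSeed (Fin n) L T) (a : Fin T × Fin n × Fin L × Bool → Bool)
    (ha : ∀ x, a x = true ↔ ∃ u ∈ sampleSet ω x, Γ.Adj x.2.1 u) :
    decodeSample a = sampledGraph Γ ω := by
  have key : ∀ t v u, (∀ b : Fin L,
      a (t, v, b, u.val.testBit b.val) = true ∧ a (t, v, b, !u.val.testBit b.val) = false) ↔
      UniqueSample Γ v (ω t v) u := by
    intro t v u
    constructor
    · intro h
      have huniq : ∀ w, Γ.Adj v w → Low (ω t v).1.val ((ω t v).2 w) → w = u := by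
        intro w hw hlow
        apply Fin.ext
        apply Nat.eq_of_testBit_eq
        intro i
        by_cases hi : i < L
        · by_contra hne
          have hf := (h ⟨i, hi⟩).2
          rw [Bool.eq_false_iff] at hf
          refine hf ((ha _).2 ⟨w, ?_, hw⟩)
          simp only [sampleSet, Finset.mem_filter, Finset.mem_univ, true_and]
          exact ⟨hlow, Bool.eq_not_of_ne hne⟩
        · have hlt : 2 ^ L ≤ 2 ^ i := Nat.pow_le_pow_right (by norm_num) (by omega)
          rw [Nat.testBit_lt_two_pow (by omega), Nat.testBit_lt_two_pow (by omega)]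
      -- Existence of a sampled neighbour is read off bit 0, so at least one bit is needed.
      obtain ⟨w, hw, hvw⟩ := (ha _).1 (h ⟨0, by omega⟩).1
      simp only [sampleSet, Finset.mem_filter, Finset.mem_univ, true_and] at hw
      obtain rfl := huniq w hvw hw.1
      exact ⟨hvw, hw.1, huniq⟩
    · rintro ⟨hvu, hlow, huniq⟩ b
      refine ⟨(ha _).2 ⟨u, ?_, hvu⟩, ?_⟩
      · simp [sampleSet, hlow]
      · rw [Bool.eq_false_iff]
        intro hcon
        obtain ⟨w, hw, hvw⟩ := (ha _).1 hcon
        simp only [sampleSet, Finset.mem_filter, Finset.mem_univ, true_and] at hw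
        obtain rfl := huniq w hvw hw.1
        simp at hw
  ext v u
  simp only [decodeSample, sampledGraph, stageGraph, SimpleGraph.fromRel_adj,
    SimpleGraph.iSup_adj, key]
  constructor
  · rintro ⟨hne, ⟨t, h⟩ | ⟨t, h⟩⟩
    · exact ⟨t, hne, Or.inl h⟩
    · exact ⟨t, hne, Or.inr h⟩
  · rintro ⟨t, hne, h | h⟩
    · exact ⟨hne, Or.inl ⟨t, h⟩⟩
    · exact ⟨hne, Or.inr ⟨t, h⟩⟩

variable {Q O : Type} {r : ℕ}

/-- The round that samples edges by queries between a vertex and a set of vertices. -/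
noncomputable def sampleRound (star : Fin n → Finset (Fin n) → Q) (ω : SampleSeed (Fin n) L T)
    (next : SimpleGraph (Fin n) → RoundAlgorithm Q O r) : RoundAlgorithm Q O (r + 1) :=
  roundOf (fun x : Fin T × Fin n × Fin L × Bool => star x.2.1 (sampleSet ω x))
    fun a => next (decodeSample a)

/-- `star v S` asks whether `v` has a neighbour in `S`. -/
def IsStarQuery (Γ : SimpleGraph (Fin n)) (oracle : Q → Bool)
    (star : Fin n → Finset (Fin n) → Q) : Prop :=
  ∀ v S, oracle (star v S) = true ↔ ∃ u ∈ S, Γ.Adj v u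

lemma run_sampleRound (hL : 1 ≤ L) (hn : n ≤ 2 ^ L) {Γ : SimpleGraph (Fin n)}
    {oracle : Q → Bool} {star : Fin n → Finset (Fin n) → Q} (hstar : IsStarQuery Γ oracle star)
    (ω : SampleSeed (Fin n) L T) (next : SimpleGraph (Fin n) → RoundAlgorithm Q O r) :
    (sampleRound star ω next).run oracle = (next (sampledGraph Γ ω)).run oracle := by
  rw [sampleRound, run_roundOf, decodeSample_eq hL hn Γ ω _ fun x => hstar _ _]

lemma numQueries_sampleRound (hL : 1 ≤ L) (hn : n ≤ 2 ^ L) {Γ : SimpleGraph (Fin n)}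
    {oracle : Q → Bool} {star : Fin n → Finset (Fin n) → Q} (hstar : IsStarQuery Γ oracle star)
    (ω : SampleSeed (Fin n) L T) (next : SimpleGraph (Fin n) → RoundAlgorithm Q O r) :
    (sampleRound star ω next).numQueries oracle
      = T * (n * (L * 2)) + (next (sampledGraph Γ ω)).numQueries oracle := by
  rw [sampleRound, numQueries_roundOf, decodeSample_eq hL hn Γ ω _ fun x => hstar _ _]
  simp

end FirstRound

/-! ### From bit length to the natural logarithm -/

section Wrapper

lemma log_two_add_one_le {n : ℕ} (hn : 2 ≤ n) : ((Nat.log 2 n + 1 : ℕ) : ℝ) ≤ 3 * Real.log n := by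
  have h1 : (2 : ℝ) ^ Nat.log 2 n ≤ n := by
    exact_mod_cast Nat.pow_log_le_self 2 (by omega)
  have h2 : (Nat.log 2 n : ℝ) * Real.log 2 ≤ Real.log n := by
    rw [← Real.log_pow]
    exact Real.log_le_log (by positivity) h1
  have h3 : Real.log 2 ≤ Real.log n := Real.log_le_log (by norm_num) (by exact_mod_cast hn)
  have h4 := Real.log_two_gt_d9
  push_cast
  have h5 : (0 : ℝ) ≤ Nat.log 2 n := by positivity
  nlinarith

/-- A family of algorithms with the right guarantees in terms of the bit length of `n`, for `n ≥ 2`,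
gives the guarantees in terms of `log n`. -/
lemma exists_algorithm_of_bitLength (Q : ℕ → Type) (answer : ∀ n, Multigraph n → Q n → Bool)
    (r c C : ℕ)
    (h : ∀ n L : ℕ, 2 ≤ n → L = Nat.log 2 n + 1 →
      ∃ (Seed : Type) (_ : Fintype Seed) (_ : Nonempty Seed)
        (alg : Seed → RoundAlgorithm (Q n) (SimpleGraph (Fin n)) r), ∀ G : Multigraph n,
        (∀ ω, (alg ω).numQueries (answer n G) ≤ C * (n * L ^ 5)) ∧
        pr (fun ω => ¬ G.IsSpanningForest ((alg ω).run (answer n G)))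
          ≤ ((2 : ℝ) ^ (c * L))⁻¹) :
    ∃ C : ℝ, ∀ n : ℕ, 1 ≤ n →
      ∃ A : RandomizedAlgorithm (Q n) (SimpleGraph (Fin n)) r,
        ∀ G : Multigraph n,
          A.MakesAtMost (answer n G) (C * n * Real.log n ^ 5) ∧
          A.failureProb (answer n G) G.IsSpanningForest ≤ ((n : ℝ≥0∞) ^ c)⁻¹ := by
  refine ⟨C * 3 ^ 5, fun n hn => ?_⟩
  rcases hn.eq_or_lt with rfl | hn2
  -- For n = 1 the logarithm vanishes and no query is allowed, but the permitted failure probability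
  -- is 1.
  · refine ⟨⟨Unit, PMF.pure (), fun _ => idle ⊥ r⟩, fun G => ⟨fun ω => ?_, ?_⟩⟩
    · simp [numQueries_idle]
    · simp only [Nat.cast_one, one_pow, inv_one]
      unfold RandomizedAlgorithm.failureProb
      refine ((PMF.toOuterMeasure _).mono (Set.subset_univ _)).trans ?_
      simp
  · obtain ⟨Seed, hfin, hne, alg, halg⟩ := h n _ hn2 rfl
    refine ⟨⟨Seed, PMF.uniformOfFintype Seed, alg⟩, fun G => ⟨fun ω => ?_, ?_⟩⟩
    · have h1 : (((alg ω).numQueries (answer n G) : ℕ) : ℝ)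
          ≤ ((C * (n * (Nat.log 2 n + 1) ^ 5) : ℕ) : ℝ) := by exact_mod_cast (halg G).1 ω
      refine h1.trans ?_
      have h2 := pow_le_pow_left₀ (by positivity) (log_two_add_one_le hn2) 5
      rw [mul_pow] at h2
      calc ((C * (n * (Nat.log 2 n + 1) ^ 5) : ℕ) : ℝ)
          = C * n * ((Nat.log 2 n + 1 : ℕ) : ℝ) ^ 5 := by push_cast; ring
        _ ≤ C * n * (3 ^ 5 * Real.log n ^ 5) := by gcongr
        _ = _ := by ring
    · refine (uniform_toOuterMeasure_le _ (halg G).2).trans ?_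
      have hlt : n < 2 ^ (Nat.log 2 n + 1) := Nat.lt_pow_succ_log_self (by norm_num) n
      have hle : n ^ c ≤ 2 ^ (c * (Nat.log 2 n + 1)) := by
        rw [mul_comm, pow_mul]
        exact Nat.pow_le_pow_left hlt.le c
      rw [ENNReal.ofReal_inv_of_pos (by positivity)]
      apply ENNReal.inv_le_inv.2
      rw [ENNReal.ofReal_pow (by norm_num), ENNReal.ofReal_ofNat]
      exact_mod_cast hle

end Wrapper

end Algorithms

/-! ### The two-round `OR` algorithm -/

section ORAlgorithm

open scoped Classical
open RoundAlgorithm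

variable {n : ℕ}

/-- The unordered pairs of distinct vertices. -/
abbrev Pairs (n : ℕ) : Type := {e : Sym2 (Fin n) // ¬ e.IsDiag}

lemma card_pairs_le (n : ℕ) : Fintype.card (Pairs n) ≤ n * n := by
  calc Fintype.card (Pairs n) ≤ Fintype.card (Sym2 (Fin n)) := Fintype.card_subtype_le _
    _ ≤ Fintype.card (Fin n × Fin n) :=
        Fintype.card_le_of_surjective (fun x => s(x.1, x.2)) fun e => by
          induction e with | _ u v => exact ⟨(u, v), rfl⟩
    _ = n * n := by simp

/-- The `OR` query asking whether `v` has a neighbour in `S`. -/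
noncomputable def starOR (v : Fin n) (S : Finset (Fin n)) : ORQuery n :=
  Finset.univ.filter fun e => ∃ u ∈ S, e.1 = s(v, u)

lemma isStarQuery_starOR (G : Multigraph n) :
    IsStarQuery G.toSimpleGraph G.answerOR starOR := by
  intro v S
  simp only [Multigraph.answerOR, decide_eq_true_eq, starOR, Finset.mem_filter, Finset.mem_univ,
    true_and]
  constructor
  · rintro ⟨e, ⟨u, hu, he⟩, hpos⟩
    rw [he] at hpos
    exact ⟨u, hu, hpos⟩
  · rintro ⟨u, hu, hadj⟩
    exact ⟨⟨s(v, u), by simpa using hadj.ne⟩, ⟨u, hu, rfl⟩, hadj⟩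

/-- The ends of the pair `e` lie in different components of `H`. -/
def Separated (H : SimpleGraph (Fin n)) (e : Pairs n) : Prop :=
  ∃ u v, e.1 = s(u, v) ∧ ¬ H.Reachable u v

lemma separated_mk {H : SimpleGraph (Fin n)} {u v : Fin n} {h : ¬ (s(u, v)).IsDiag} :
    Separated H ⟨s(u, v), h⟩ ↔ ¬ H.Reachable u v := by
  constructor
  · rintro ⟨a, b, hab, hnot⟩ huv
    rcases Sym2.eq_iff.1 hab with ⟨rfl, rfl⟩ | ⟨rfl, rfl⟩
    · exact hnot huv
    · exact hnot huv.symm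
  · exact fun h => ⟨u, v, rfl, h⟩

/-- The pairs with an edge of `G` that `H` does not connect. -/
noncomputable def openPairs (G : Multigraph n) (H : SimpleGraph (Fin n)) : Finset (Pairs n) :=
  Finset.univ.filter fun e => Separated H e ∧ 0 < G.mult e.1

lemma card_openPairs_le (G : Multigraph n) (H : SimpleGraph (Fin n)) :
    (openPairs G H).card ≤ ∑ v, (leftover G.toSimpleGraph H v).card := by
  rw [← Finset.card_sigma, ← Finset.card_map (Function.Embedding.subtype _)]
  refine (Finset.card_le_card (t := (Finset.univ.sigma fun v =>
    leftover G.toSimpleGraph H v).image fun x => s(x.1, x.2)) ?_).trans Finset.card_image_le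
  intro e he
  obtain ⟨⟨e, hdiag⟩, hmem, rfl⟩ := Finset.mem_map.1 he
  obtain ⟨-, hsep, hpos⟩ := Finset.mem_filter.1 hmem
  induction e with | _ u v =>
  refine Finset.mem_image.2 ⟨⟨u, v⟩, ?_, rfl⟩
  simp only [Finset.mem_sigma, Finset.mem_univ, true_and, leftover, Finset.mem_filter]
  exact ⟨hpos, separated_mk.1 hsep⟩

/-- The final round: group testing of all pairs that `H` does not connect. -/
noncomputable def pairRound {N m : ℕ} [NeZero m] (ρ : Fin N → Pairs n → Fin m)
    (H : SimpleGraph (Fin n)) : RoundAlgorithm (ORQuery n) (SimpleGraph (Fin n)) 1 :=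
  roundOf (fun i : Fin N => Finset.univ.filter fun e : Pairs n => ρ i e = 0 ∧ Separated H e)
    fun b => output (forestOf (H ⊔ SimpleGraph.fromRel fun u v =>
      ∃ h, Separated H ⟨s(u, v), h⟩ ∧ ∀ i, ρ i ⟨s(u, v), h⟩ = 0 → b i = true))

lemma numQueries_pairRound {N m : ℕ} [NeZero m] (ρ : Fin N → Pairs n → Fin m)
    (H : SimpleGraph (Fin n)) (oracle : ORQuery n → Bool) :
    (pairRound ρ H).numQueries oracle = N := by
  simp [pairRound, numQueries_roundOf, numQueries]

/-- A pair is kept when none of its tests is negative. Edges always survive; by `hρ` every other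
separated pair lies in a negative test, so exactly the open pairs are added to `H`. -/
lemma isSpanningForest_pairRound {N m : ℕ} [NeZero m] (ρ : Fin N → Pairs n → Fin m)
    (G : Multigraph n) {H : SimpleGraph (Fin n)} (hH : H ≤ G.toSimpleGraph)
    (hρ : ∀ e ∉ openPairs G H, ∃ i ∈ (Finset.univ : Finset (Fin N)),
      ρ i e = 0 ∧ ∀ e' ∈ openPairs G H, ¬ ρ i e' = 0) :
    G.IsSpanningForest ((pairRound ρ H).run G.answerOR) := by
  rw [pairRound, run_roundOf, run]
  have hans : ∀ i, G.answerOR (Finset.univ.filter fun e : Pairs n => ρ i e = 0 ∧ Separated H e)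
      = true ↔ ∃ e ∈ openPairs G H, ρ i e = 0 := by
    intro i
    simp only [Multigraph.answerOR, decide_eq_true_eq, openPairs, Finset.mem_filter,
      Finset.mem_univ, true_and]
    exact exists_congr fun e => by tauto
  have hkept : ∀ u v, (∃ h, Separated H ⟨s(u, v), h⟩ ∧ ∀ i, ρ i ⟨s(u, v), h⟩ = 0 →
      G.answerOR (Finset.univ.filter fun e : Pairs n => ρ i e = 0 ∧ Separated H e) = true) ↔
      G.toSimpleGraph.Adj u v ∧ ¬ H.Reachable u v := by
    intro u v
    constructor
    · rintro ⟨h, hsep, hall⟩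
      by_contra hcon
      have hnot : (⟨s(u, v), h⟩ : Pairs n) ∉ openPairs G H := fun hmem =>
        hcon ⟨(Finset.mem_filter.1 hmem).2.2, separated_mk.1 hsep⟩
      obtain ⟨i, -, hi, havoid⟩ := hρ _ hnot
      obtain ⟨e, he, hei⟩ := (hans i).1 (hall i hi)
      exact havoid e he hei
    · rintro ⟨hadj, hnot⟩
      have h : ¬ (s(u, v)).IsDiag := by simpa using hadj.ne
      refine ⟨h, separated_mk.2 hnot, fun i hi => (hans i).2 ⟨_, ?_, hi⟩⟩
      exact Finset.mem_filter.2 ⟨Finset.mem_univ _, separated_mk.2 hnot, hadj⟩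
  simp only [hkept]
  apply isSpanningForest_forestOf
  · refine sup_le hH fun u v huv => ?_
    rcases ((SimpleGraph.fromRel_adj _ _ _).1 huv).2 with h | h
    · exact h.1
    · exact h.1.symm
  · intro u v huv
    by_cases h : H.Reachable u v
    · exact h.mono le_sup_left
    · refine SimpleGraph.Adj.reachable (Or.inr ?_)
      exact (SimpleGraph.fromRel_adj _ _ _).2 ⟨huv.ne, Or.inl ⟨huv, h⟩⟩

lemma pr_eq_zero_fin (m : ℕ) [NeZero m] : pr (fun x : Fin m => x = 0) = 1 / m := by
  rw [pr_eq, Fintype.card_fin]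
  simp [Finset.filter_eq']

lemma pr_pairRound_fail_le (G : Multigraph n) {H : SimpleGraph (Fin n)}
    (hH : H ≤ G.toSimpleGraph) {m N k : ℕ} [NeZero m]
    (hm : 2 * ∑ v, (leftover G.toSimpleGraph H v).card ≤ m) (hN : N = 2 * m * k) :
    pr (fun ρ : Fin N → Pairs n → Fin m =>
      ¬ G.IsSpanningForest ((pairRound ρ H).run G.answerOR))
      ≤ (n * n : ℝ) * ((2 : ℝ) ^ k)⁻¹ := by
  have hmR : (0 : ℝ) < m := by exact_mod_cast Nat.pos_of_ne_zero (NeZero.ne m)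
  have hD : ((openPairs G H).card : ℝ) * pr (fun x : Fin m => x = 0) ≤ 1 / 2 := by
    rw [pr_eq_zero_fin, mul_one_div, div_le_div_iff₀ hmR (by norm_num)]
    have : (openPairs G H).card * 2 ≤ 1 * m := by
      have := card_openPairs_le G H
      omega
    exact_mod_cast this
  have hk : (k : ℝ) ≤ (Finset.univ : Finset (Fin N)).card * (pr (fun x : Fin m => x = 0) / 2) := by
    rw [pr_eq_zero_fin, Finset.card_univ, Fintype.card_fin, hN]
    push_cast
    field_simp
    exact le_rfl
  have htest := pr_groupTest_fail_le (fun x : Fin m => x = 0) (openPairs G H) hD _ hk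
  have hmono : pr (fun ρ : Fin N → Pairs n → Fin m =>
      ¬ G.IsSpanningForest ((pairRound ρ H).run G.answerOR)) ≤
      pr (fun ρ : Fin N → Pairs n → Fin m => ¬ ∀ e ∉ openPairs G H,
        ∃ i ∈ (Finset.univ : Finset (Fin N)),
          ρ i e = 0 ∧ ∀ e' ∈ openPairs G H, ¬ ρ i e' = 0) :=
    pr_mono fun ρ hρ h => hρ (isSpanningForest_pairRound ρ G hH h)
  refine hmono.trans (htest.trans ?_)
  have hpairs : (Fintype.card (Pairs n) : ℝ) ≤ n * n := by exact_mod_cast card_pairs_le n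
  exact mul_le_mul_of_nonneg_right hpairs (by positivity)

/-- The two-round `OR` algorithm. -/
theorem exists_algorithm_OR (c n L : ℕ) (hn : 2 ≤ n) (hL : L = Nat.log 2 n + 1) :
    ∃ (Seed : Type) (_ : Fintype Seed) (_ : Nonempty Seed)
      (alg : Seed → RoundAlgorithm (ORQuery n) (SimpleGraph (Fin n)) 2), ∀ G : Multigraph n,
      (∀ ω, (alg ω).numQueries G.answerOR ≤ 2000 * (c + 3) * (n * L ^ 5)) ∧
      pr (fun ω => ¬ G.IsSpanningForest ((alg ω).run G.answerOR)) ≤ ((2 : ℝ) ^ (c * L))⁻¹ := by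
  have hL1 : 1 ≤ L := by omega
  have hlt : n < 2 ^ L := hL ▸ Nat.lt_pow_succ_log_self (by norm_num) n
  -- The stages leave more than 4nL edge ends with probability at most n 2^(-(c+2)L). The modulus
  -- `m` is twice 4nL, making the test density 1/m small enough, and `N` tests leave failure n²
  -- 2^(-(c+3)L).
  obtain ⟨T, hT⟩ : ∃ T, T = 320 * (L + 2) * ((c + 2) * L) := ⟨_, rfl⟩
  obtain ⟨m, hm⟩ : ∃ m, m = 8 * (n * L) := ⟨_, rfl⟩
  obtain ⟨N, hN⟩ : ∃ N, N = 2 * m * ((c + 3) * L) := ⟨_, rfl⟩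
  have hm0 : 0 < m := by rw [hm]; positivity
  have : NeZero m := ⟨hm0.ne'⟩
  refine ⟨SampleSeed (Fin n) L T × (Fin N → Pairs n → Fin m), instFintypeProd _ _, inferInstance,
    fun ω => sampleRound starOR ω.1 (pairRound ω.2), fun G => ⟨fun ω => ?_, ?_⟩⟩
  · rw [numQueries_sampleRound hL1 hlt.le (isStarQuery_starOR G), numQueries_pairRound, hN, hm, hT]
    have h2 : L ^ 3 ≤ L ^ 5 := Nat.pow_le_pow_right hL1 (by norm_num)
    have h3 : L ^ 2 ≤ L ^ 5 := Nat.pow_le_pow_right hL1 (by norm_num)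
    calc 320 * (L + 2) * ((c + 2) * L) * (n * (L * 2)) + 2 * (8 * (n * L)) * ((c + 3) * L)
        ≤ 320 * (3 * L) * ((c + 3) * L) * (n * (L * 2)) + 2 * (8 * (n * L)) * ((c + 3) * L) := by
          gcongr <;> omega
      _ = 1920 * ((c + 3) * n) * L ^ 3 + 16 * ((c + 3) * n) * L ^ 2 := by ring
      _ ≤ 1920 * ((c + 3) * n) * L ^ 5 + 16 * ((c + 3) * n) * L ^ 5 := by gcongr
      _ = 1936 * ((c + 3) * (n * L ^ 5)) := by ring
      _ ≤ 2000 * ((c + 3) * (n * L ^ 5)) := by gcongr; norm_num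
      _ = _ := by ring
  · simp only [run_sampleRound hL1 hlt.le (isStarQuery_starOR G)]
    have hn2 : (n : ℝ) ≤ 2 ^ L := by exact_mod_cast hlt.le
    have hlarge := pr_leftover_large_le (V := Fin n) (by simpa using hlt) G.toSimpleGraph hT
    have hsecond : ∀ ω : SampleSeed (Fin n) L T,
        ¬ ¬ ∑ v, (leftover G.toSimpleGraph (sampledGraph G.toSimpleGraph ω) v).card
          ≤ 4 * (Fintype.card (Fin n) * L) →
        pr (fun ρ : Fin N → Pairs n → Fin m => ¬ G.IsSpanningForest
          ((pairRound ρ (sampledGraph G.toSimpleGraph ω)).run G.answerOR))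
          ≤ (n * n : ℝ) * ((2 : ℝ) ^ ((c + 3) * L))⁻¹ := by
      intro ω hω
      rw [not_not, Fintype.card_fin] at hω
      exact pr_pairRound_fail_le G (sampledGraph_le _ ω) (by omega) hN
    have hprod := pr_prod_le (fun ω : SampleSeed (Fin n) L T × (Fin N → Pairs n → Fin m) =>
        ¬ G.IsSpanningForest
          ((pairRound ω.2 (sampledGraph G.toSimpleGraph ω.1)).run G.answerOR)) _
      (δ := (n * n : ℝ) * ((2 : ℝ) ^ ((c + 3) * L))⁻¹) (by positivity) hsecond
    rw [Fintype.card_fin] at hlarge hprod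
    refine hprod.trans ?_
    refine (add_le_add_left hlarge _).trans ?_
    have hL2 : (2 : ℝ) ≤ 2 ^ L := by
      calc (2 : ℝ) = 2 ^ 1 := by norm_num
        _ ≤ 2 ^ L := pow_le_pow_right₀ (by norm_num) hL1
    set X : ℝ := 2 ^ L with hX
    have e1 : (2 : ℝ) ^ ((c + 2) * L) = X ^ 2 * X ^ c := by rw [hX]; ring
    have e2 : (2 : ℝ) ^ ((c + 3) * L) = X ^ 3 * X ^ c := by rw [hX]; ring
    have e3 : (2 : ℝ) ^ (c * L) = X ^ c := by rw [hX]; ring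
    have hX0 : 0 < X := by positivity
    rw [e1, e2, e3]
    calc n * (X ^ 2 * X ^ c)⁻¹ + n * n * (X ^ 3 * X ^ c)⁻¹
        ≤ X * (X ^ 2 * X ^ c)⁻¹ + X * X * (X ^ 3 * X ^ c)⁻¹ := by gcongr
      _ = (2 / X) * (X ^ c)⁻¹ := by field_simp; norm_num
      _ ≤ 1 * (X ^ c)⁻¹ := by
          gcongr
          rw [div_le_one hX0]
          exact hL2
      _ = _ := one_mul _

end ORAlgorithm

/-! ### Degree estimation and recovery with `BIS` queries -/

section BISAlgorithm

open scoped Classical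
open RoundAlgorithm

variable {n : ℕ}

/-- The `BIS` query asking whether `v` has a neighbour in `S`. -/
def starBIS (v : Fin n) (S : Finset (Fin n)) : BISQuery n :=
  ⟨{v}, S.erase v, by simp⟩

lemma isStarQuery_starBIS (G : Multigraph n) :
    IsStarQuery G.toSimpleGraph G.answerBIS starBIS := by
  intro v S
  simp only [Multigraph.answerBIS, decide_eq_true_eq, starBIS, Finset.mem_singleton,
    exists_eq_left, Finset.mem_erase]
  constructor
  · rintro ⟨u, hu, hpos⟩
    exact ⟨u, hu.2, hpos⟩
  · rintro ⟨u, hu, hadj⟩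
    exact ⟨u, ⟨hadj.ne', hu⟩, hadj⟩

variable {Q O : Type} {r L ℓ K : ℕ}

/-- The lowest level at which some test of `v` is negative. -/
noncomputable def estimateLevel (a : Fin n × Fin (L + 2) × Fin ℓ → Bool) (v : Fin n) : ℕ :=
  sInf {j | ∃ (j' : Fin (L + 2)) (i : Fin ℓ), j'.val = j ∧ a (v, j', i) = false}

/-- The bound covers the case without negative tests, where the infimum of the empty set is 0. -/
lemma estimateLevel_le (a : Fin n × Fin (L + 2) × Fin ℓ → Bool) (v : Fin n) :
    estimateLevel a v ≤ L + 1 := by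
  rcases Set.eq_empty_or_nonempty
    {j | ∃ (j' : Fin (L + 2)) (i : Fin ℓ), j'.val = j ∧ a (v, j', i) = false} with h | h
  · rw [estimateLevel, h]
    simp
  · obtain ⟨j', i, hj, -⟩ := Nat.sInf_mem h
    have := j'.isLt
    unfold estimateLevel
    omega

/-- The vertices in other components of `H` than `v` that belong to the random set `ρ` of density
`2 ^ (-j)`. -/
noncomputable def testSet (H : SimpleGraph (Fin n)) (v : Fin n) (j : ℕ) (ρ : Fin n → Fin (2 ^ K)) :
    Finset (Fin n) :=
  Finset.univ.filter fun u => ¬ H.Reachable v u ∧ Low j (ρ u)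

lemma exists_mem_testSet {Γ H : SimpleGraph (Fin n)} {v : Fin n} {j : ℕ}
    {ρ : Fin n → Fin (2 ^ K)} :
    (∃ u ∈ testSet H v j ρ, Γ.Adj v u) ↔ ∃ u ∈ leftover Γ H v, Low j (ρ u) := by
  simp only [testSet, leftover, Finset.mem_filter, Finset.mem_univ, true_and]
  exact exists_congr fun u => by tauto

/-- The seed of the round that estimates degrees. -/
abbrev EstimateSeed (n L ℓ K : ℕ) : Type :=
  Fin n → Fin (L + 2) → Fin ℓ → Fin n → Fin (2 ^ K)

/-- The round that estimates, for every vertex, how many edges leave its component of `H`. -/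
noncomputable def estimateRound (star : Fin n → Finset (Fin n) → Q) (ρ : EstimateSeed n L ℓ K)
    (H : SimpleGraph (Fin n)) (next : (Fin n → ℕ) → RoundAlgorithm Q O r) :
    RoundAlgorithm Q O (r + 1) :=
  roundOf (fun x : Fin n × Fin (L + 2) × Fin ℓ =>
    star x.1 (testSet H x.1 x.2.1.val (ρ x.1 x.2.1 x.2.2))) fun a => next (estimateLevel a)

/-- The levels that the estimating round computes. -/
noncomputable def levels (Γ H : SimpleGraph (Fin n)) (ρ : EstimateSeed n L ℓ K) : Fin n → ℕ :=
  estimateLevel fun x : Fin n × Fin (L + 2) × Fin ℓ =>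
    decide (∃ u ∈ leftover Γ H x.1, Low x.2.1.val (ρ x.1 x.2.1 x.2.2 u))

section

variable {Γ : SimpleGraph (Fin n)} {oracle : Q → Bool} {star : Fin n → Finset (Fin n) → Q}

lemma oracle_star_testSet (hstar : IsStarQuery Γ oracle star) (H : SimpleGraph (Fin n))
    (v : Fin n) (j : ℕ) (ρ : Fin n → Fin (2 ^ K)) :
    oracle (star v (testSet H v j ρ)) = decide (∃ u ∈ leftover Γ H v, Low j (ρ u)) := by
  rw [Bool.eq_iff_iff, hstar, exists_mem_testSet, decide_eq_true_eq]

lemma run_estimateRound (hstar : IsStarQuery Γ oracle star) (ρ : EstimateSeed n L ℓ K)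
    (H : SimpleGraph (Fin n)) (next : (Fin n → ℕ) → RoundAlgorithm Q O r) :
    (estimateRound star ρ H next).run oracle = (next (levels Γ H ρ)).run oracle := by
  simp only [estimateRound, run_roundOf, oracle_star_testSet hstar, levels]

lemma numQueries_estimateRound (hstar : IsStarQuery Γ oracle star) (ρ : EstimateSeed n L ℓ K)
    (H : SimpleGraph (Fin n)) (next : (Fin n → ℕ) → RoundAlgorithm Q O r) :
    (estimateRound star ρ H next).numQueries oracle
      = n * ((L + 2) * ℓ) + (next (levels Γ H ρ)).numQueries oracle := by
  simp only [estimateRound, numQueries_roundOf, oracle_star_testSet hstar, levels]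
  simp

end

/-- The levels approximate the numbers of leftover edges at the vertices. -/
def GoodLevels (Γ H : SimpleGraph (Fin n)) (s : ℕ) (lev : Fin n → ℕ) : Prop :=
  ∀ v, (leftover Γ H v).card ≤ 2 ^ lev v * 2 ^ s ∧
    2 ^ lev v ≤ 4 * (leftover Γ H v).card + 1

lemma pr_not_goodLevels_le (Γ H : SimpleGraph (Fin n)) {s : ℕ} (hK : L + 1 ≤ K) (hs : ℓ ≤ 2 ^ s)
    (hn : n ≤ 2 ^ L) :
    pr (fun ρ : EstimateSeed n L ℓ K => ¬ GoodLevels Γ H s (levels Γ H ρ))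
      ≤ n * (((L + 2) * ℓ + 1) * ((2 : ℝ) ^ ℓ)⁻¹) := by
  have hv : ∀ v : Fin n, pr (fun ρ : EstimateSeed n L ℓ K => ¬
      ((∀ j i, (∀ u ∈ leftover Γ H v, ¬ Low j.val (ρ v j i u)) →
          (leftover Γ H v).card ≤ 2 ^ j.val * 2 ^ s) ∧
        ∃ j i, (∀ u ∈ leftover Γ H v, ¬ Low j.val (ρ v j i u)) ∧
          2 ^ j.val ≤ 4 * (leftover Γ H v).card + 1))
      ≤ ((L + 2) * ℓ + 1) * ((2 : ℝ) ^ ℓ)⁻¹ := by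
    intro v
    rw [pr_coord v fun r : Fin (L + 2) → Fin ℓ → Fin n → Fin (2 ^ K) => ¬
      ((∀ j i, (∀ u ∈ leftover Γ H v, ¬ Low j.val (r j i u)) →
          (leftover Γ H v).card ≤ 2 ^ j.val * 2 ^ s) ∧
        ∃ j i, (∀ u ∈ leftover Γ H v, ¬ Low j.val (r j i u)) ∧
          2 ^ j.val ≤ 4 * (leftover Γ H v).card + 1)]
    refine pr_sizeEstimate_fail_le hK hs _ ((Finset.card_le_univ _).trans ?_)
    simpa using hn
  have hall := pr_exists_le_of_forall_le _ hv
  rw [Fintype.card_fin] at hall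
  refine le_trans (pr_mono fun ρ hρ => ?_) hall
  by_contra hcon
  push Not at hcon
  refine hρ fun v => ?_
  obtain ⟨h1, j, i, hneg, hj⟩ := hcon v
  have hmem : j.val ∈ {j | ∃ (j' : Fin (L + 2)) (i : Fin ℓ), j'.val = j ∧
      decide (∃ u ∈ leftover Γ H v, Low j'.val (ρ v j' i u)) = false} :=
    ⟨j, i, rfl, by simpa using hneg⟩
  have hle : levels Γ H ρ v ≤ j.val := Nat.sInf_le hmem
  -- The minimum is attained by an actual negative test, which certifies the upper bound on the
  -- leftover degree; minimality gives the other inequality.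
  obtain ⟨j', i', hj', hneg'⟩ := Nat.sInf_mem ⟨j.val, hmem⟩
  have hlev : j'.val = levels Γ H ρ v := hj'
  refine ⟨hlev ▸ h1 j' i' (by simpa using hneg'), le_trans ?_ hj⟩
  exact Nat.pow_le_pow_right (by norm_num) hle

/-- The number of tests of `v` in the recovering round: none at all if the budget is exceeded. -/
def numTests (s k cap : ℕ) (lev : Fin n → ℕ) (v : Fin n) : ℕ :=
  if ∑ w, 2 * 2 ^ (lev w + 1 + s) * k ≤ cap then 2 * 2 ^ (lev v + 1 + s) * k else 0

lemma sum_numTests_le (s k cap : ℕ) (lev : Fin n → ℕ) : ∑ v, numTests s k cap lev v ≤ cap := by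
  by_cases h : ∑ w, 2 * 2 ^ (lev w + 1 + s) * k ≤ cap
  · simp only [numTests, h, if_true]
  · simp [numTests, h]

/-- The indices of the tests in the recovering round. -/
abbrev TestIndex (M s k cap : ℕ) (lev : Fin n → ℕ) : Type :=
  {x : Fin n × Fin M // x.2.val < numTests s k cap lev x.1}

lemma card_testIndex_le (M s k cap : ℕ) (lev : Fin n → ℕ) :
    Fintype.card (TestIndex M s k cap lev) ≤ cap := by
  refine le_trans ?_ (sum_numTests_le s k cap lev)
  have h := Fintype.card_le_of_injective
    (fun x : TestIndex M s k cap lev =>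
      (⟨x.1.1, x.1.2.val, x.2⟩ : Σ v : Fin n, Fin (numTests s k cap lev v))) (by
      rintro ⟨⟨v, i⟩, hx⟩ ⟨⟨w, j⟩, hy⟩ hxy
      simp only [Sigma.mk.injEq] at hxy
      obtain ⟨rfl, h2⟩ := hxy
      simp only [heq_eq_eq, Fin.mk.injEq] at h2
      simp only [Subtype.mk.injEq, Prod.mk.injEq, true_and]
      exact Fin.ext h2)
  simpa using h

/-- The round that recovers the leftover edges by group testing at every vertex, followed by an
empty round. -/
noncomputable def recoverRound {M : ℕ} (s k cap : ℕ) (star : Fin n → Finset (Fin n) → Q)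
    (ρ : Fin n → Fin M → Fin n → Fin (2 ^ K)) (H : SimpleGraph (Fin n)) (lev : Fin n → ℕ) :
    RoundAlgorithm Q (SimpleGraph (Fin n)) 2 :=
  roundOf (fun x : TestIndex M s k cap lev =>
      star x.1.1 (testSet H x.1.1 (lev x.1.1 + 1 + s) (ρ x.1.1 x.1.2)))
    fun b => idle (forestOf (H ⊔ SimpleGraph.fromRel fun v u => ¬ H.Reachable v u ∧
      ∀ x : TestIndex M s k cap lev, x.1.1 = v → Low (lev v + 1 + s) (ρ v x.1.2 u) →
        b x = true)) 1

lemma numQueries_recoverRound_le {M : ℕ} (s k cap : ℕ) (star : Fin n → Finset (Fin n) → Q)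
    (ρ : Fin n → Fin M → Fin n → Fin (2 ^ K)) (H : SimpleGraph (Fin n)) (lev : Fin n → ℕ)
    (oracle : Q → Bool) : (recoverRound s k cap star ρ H lev).numQueries oracle ≤ cap := by
  rw [recoverRound, numQueries_roundOf, numQueries_idle]
  exact card_testIndex_le M s k cap lev

lemma isSpanningForest_recoverRound {M : ℕ} (s k cap : ℕ) {star : Fin n → Finset (Fin n) → Q}
    (ρ : Fin n → Fin M → Fin n → Fin (2 ^ K)) (G : Multigraph n) {oracle : Q → Bool}
    (hstar : IsStarQuery G.toSimpleGraph oracle star) {H : SimpleGraph (Fin n)}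
    (hH : H ≤ G.toSimpleGraph) (lev : Fin n → ℕ)
    (hρ : ∀ v, ∀ u ∉ leftover G.toSimpleGraph H v,
      ∃ i ∈ Finset.univ.filter fun i : Fin M => i.val < numTests s k cap lev v,
        Low (lev v + 1 + s) (ρ v i u) ∧
          ∀ u' ∈ leftover G.toSimpleGraph H v, ¬ Low (lev v + 1 + s) (ρ v i u')) :
    G.IsSpanningForest ((recoverRound s k cap star ρ H lev).run oracle) := by
  rw [recoverRound, run_roundOf, run_idle]
  simp only [oracle_star_testSet hstar, decide_eq_true_eq]
  have hkept : ∀ v u, (¬ H.Reachable v u ∧ ∀ x : TestIndex M s k cap lev, x.1.1 = v →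
      Low (lev v + 1 + s) (ρ v x.1.2 u) → ∃ w ∈ leftover G.toSimpleGraph H x.1.1,
        Low (lev x.1.1 + 1 + s) (ρ x.1.1 x.1.2 w)) ↔
      G.toSimpleGraph.Adj v u ∧ ¬ H.Reachable v u := by
    intro v u
    constructor
    · rintro ⟨hnot, hall⟩
      by_contra hcon
      have hu : u ∉ leftover G.toSimpleGraph H v := by
        simp only [leftover, Finset.mem_filter, Finset.mem_univ, true_and]
        exact hcon
      obtain ⟨i, hi, hlow, havoid⟩ := hρ v u hu
      obtain ⟨w, hw, hwlow⟩ := hall ⟨(v, i), (Finset.mem_filter.1 hi).2⟩ rfl hlow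
      exact havoid w hw hwlow
    · rintro ⟨hadj, hnot⟩
      refine ⟨hnot, ?_⟩
      rintro x rfl hlow
      refine ⟨u, ?_, hlow⟩
      simp only [leftover, Finset.mem_filter, Finset.mem_univ, true_and]
      exact ⟨hadj, hnot⟩
  simp only [hkept]
  apply isSpanningForest_forestOf
  · refine sup_le hH fun u v huv => ?_
    rcases ((SimpleGraph.fromRel_adj _ _ _).1 huv).2 with h | h
    · exact h.1
    · exact h.1.symm
  · intro u v huv
    by_cases h : H.Reachable u v
    · exact h.mono le_sup_left
    · refine SimpleGraph.Adj.reachable (Or.inr ?_)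
      exact (SimpleGraph.fromRel_adj _ _ _).2 ⟨huv.ne, Or.inl ⟨huv, h⟩⟩

/-- At level `lev v + 1 + s` the expected number of leftover neighbours in a test is at most 1/2, so
group testing works at each vertex. One factor `n` is the union bound over vertices, the other over
candidate neighbours. -/
lemma pr_recoverRound_fail_le {M s k cap : ℕ} {star : Fin n → Finset (Fin n) → Q}
    (G : Multigraph n) {oracle : Q → Bool} (hstar : IsStarQuery G.toSimpleGraph oracle star)
    {H : SimpleGraph (Fin n)} (hH : H ≤ G.toSimpleGraph) {lev : Fin n → ℕ}
    (hlev : ∀ v, lev v + 1 + s ≤ K) (hM : M = 2 * 2 ^ K * k)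
    (hgood : GoodLevels G.toSimpleGraph H s lev)
    (hcap : ∑ w, 2 * 2 ^ (lev w + 1 + s) * k ≤ cap) :
    pr (fun ρ : Fin n → Fin M → Fin n → Fin (2 ^ K) =>
      ¬ G.IsSpanningForest ((recoverRound s k cap star ρ H lev).run oracle))
      ≤ n * (n * ((2 : ℝ) ^ k)⁻¹) := by
  have hnum : ∀ v, numTests s k cap lev v = 2 * 2 ^ (lev v + 1 + s) * k := fun v => if_pos hcap
  have hv : ∀ v : Fin n, pr (fun ρ : Fin n → Fin M → Fin n → Fin (2 ^ K) =>
      ¬ ∀ u ∉ leftover G.toSimpleGraph H v,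
        ∃ i ∈ Finset.univ.filter fun i : Fin M => i.val < numTests s k cap lev v,
          Low (lev v + 1 + s) (ρ v i u) ∧
            ∀ u' ∈ leftover G.toSimpleGraph H v, ¬ Low (lev v + 1 + s) (ρ v i u'))
      ≤ n * ((2 : ℝ) ^ k)⁻¹ := by
    intro v
    rw [pr_coord v fun r : Fin M → Fin n → Fin (2 ^ K) =>
      ¬ ∀ u ∉ leftover G.toSimpleGraph H v,
        ∃ i ∈ Finset.univ.filter fun i : Fin M => i.val < numTests s k cap lev v,
          Low (lev v + 1 + s) (r i u) ∧
            ∀ u' ∈ leftover G.toSimpleGraph H v, ¬ Low (lev v + 1 + s) (r i u')]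
    have hp := pr_low (hlev v)
    have hD : ((leftover G.toSimpleGraph H v).card : ℝ) * pr (Low (K := K) (lev v + 1 + s))
        ≤ 1 / 2 := by
      rw [hp, mul_one_div, div_le_div_iff₀ (by positivity) (by norm_num)]
      have : (leftover G.toSimpleGraph H v).card * 2 ≤ 1 * 2 ^ (lev v + 1 + s) := by
        calc _ ≤ 2 ^ lev v * 2 ^ s * 2 := by gcongr; exact (hgood v).1
          _ = _ := by ring
      exact_mod_cast this
    have hcard : (Finset.univ.filter fun i : Fin M => i.val < numTests s k cap lev v).card
        = 2 * 2 ^ (lev v + 1 + s) * k := by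
      -- The seed type cannot depend on the estimated levels; `M` is the number of tests at the top
      -- level `K`, so none is cut off.
      rw [Fin.card_filter_val_lt, hnum, min_eq_right]
      rw [hM]
      gcongr
      · norm_num
      · exact hlev v
    have hk : (k : ℝ) ≤ (Finset.univ.filter fun i : Fin M =>
        i.val < numTests s k cap lev v).card * (pr (Low (K := K) (lev v + 1 + s)) / 2) := by
      rw [hcard, hp]
      push_cast
      field_simp
      exact le_rfl
    have htest := pr_groupTest_fail_le (Low (K := K) (lev v + 1 + s))
      (leftover G.toSimpleGraph H v) hD _ hk
    rwa [Fintype.card_fin] at htest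
  have hall := pr_exists_le_of_forall_le _ hv
  rw [Fintype.card_fin] at hall
  refine le_trans (pr_mono fun ρ hρ => ?_) hall
  by_contra hcon
  rw [not_exists] at hcon
  exact hρ (isSpanningForest_recoverRound s k cap ρ G hstar hH lev fun v => not_not.1 (hcon v))

/-- The levels overestimate the leftover degrees by at most a factor of order `ℓ`, and the extra 1
per vertex adds only `n`. Hence 136 = 8(4 · 4 + 1). -/
lemma sum_tests_le {Γ H : SimpleGraph (Fin n)} {s k : ℕ} {lev : Fin n → ℕ}
    (hgood : GoodLevels Γ H s lev) (hs : 2 ^ s ≤ 2 * ℓ) (hL : 1 ≤ L)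
    (hsum : ∑ v, (leftover Γ H v).card ≤ 4 * (n * L)) :
    ∑ w, 2 * 2 ^ (lev w + 1 + s) * k ≤ 136 * (ℓ * k * (n * L)) := by
  calc ∑ w, 2 * 2 ^ (lev w + 1 + s) * k
      ≤ ∑ w, (8 * (ℓ * k)) * (4 * (leftover Γ H w).card + 1) := by
        refine Finset.sum_le_sum fun w _ => ?_
        calc 2 * 2 ^ (lev w + 1 + s) * k = 4 * k * (2 ^ s * 2 ^ lev w) := by ring
          _ ≤ 4 * k * ((2 * ℓ) * (4 * (leftover Γ H w).card + 1)) := by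
              gcongr
              exact (hgood w).2
          _ = _ := by ring
    _ = (8 * (ℓ * k)) * (4 * ∑ w, (leftover Γ H w).card + n) := by
        rw [← Finset.mul_sum, Finset.sum_add_distrib, ← Finset.mul_sum]
        simp
    _ ≤ (8 * (ℓ * k)) * (4 * (4 * (n * L)) + n * L) := by
        gcongr
        exact Nat.le_mul_of_pos_right n hL
    _ = _ := by ring

end BISAlgorithm

/-! ### The four-round `BIS` algorithm and the main theorem -/

section MainAlgorithm

open scoped Classical
open RoundAlgorithm

/-- Half of the exponent `2 * r` absorbs the number of tests in the union bound. -/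
lemma estimate_error_le {L r : ℕ} (hL : 1 ≤ L) :
    (((L + 2) * (2 * r : ℕ) + 1) * ((2 : ℝ) ^ (2 * r))⁻¹) ≤ (2 ^ L) ^ 3 * ((2 : ℝ) ^ r)⁻¹ := by
  have h1 : L + 2 ≤ 2 ^ (L + 1) := by
    have := Nat.lt_two_pow_self (n := L)
    rw [pow_succ]
    omega
  have h2 : 2 * r + 1 ≤ 2 ^ (r + 1) := by
    have := Nat.lt_two_pow_self (n := r)
    rw [pow_succ]
    omega
  have h3 : (L + 2) * (2 * r) + 1 ≤ (2 ^ L) ^ 3 * 2 ^ r := by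
    calc (L + 2) * (2 * r) + 1 ≤ (L + 2) * (2 * r + 1) := by
          rw [mul_add]
          omega
      _ ≤ 2 ^ (L + 1) * 2 ^ (r + 1) := Nat.mul_le_mul h1 h2
      _ = 2 ^ (L + 2) * 2 ^ r := by ring
      _ ≤ 2 ^ (L * 3) * 2 ^ r := by
          gcongr
          · norm_num
          · omega
      _ = _ := by rw [pow_mul]
  have h4 : ((L + 2) * (2 * r : ℕ) + 1 : ℝ) ≤ (2 ^ L) ^ 3 * 2 ^ r := by exact_mod_cast h3
  calc _ ≤ ((2 ^ L) ^ 3 * 2 ^ r) * ((2 : ℝ) ^ (2 * r))⁻¹ := by gcongr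
    _ = _ := by
        rw [two_mul, pow_add]
        field_simp

/-- The four-round `BIS` algorithm. -/
theorem exists_algorithm_BIS (c n L : ℕ) (hn : 2 ≤ n) (hL : L = Nat.log 2 n + 1) :
    ∃ (Seed : Type) (_ : Fintype Seed) (_ : Nonempty Seed)
      (alg : Seed → RoundAlgorithm (BISQuery n) (SimpleGraph (Fin n)) 4), ∀ G : Multigraph n,
      (∀ ω, (alg ω).numQueries G.answerBIS ≤ 2200 * (c + 6) ^ 2 * (n * L ^ 5)) ∧
      pr (fun ω => ¬ G.IsSpanningForest ((alg ω).run G.answerBIS)) ≤ ((2 : ℝ) ^ (c * L))⁻¹ := by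
  have hL1 : 1 ≤ L := by omega
  have hlt : n < 2 ^ L := hL ▸ Nat.lt_pow_succ_log_self (by norm_num) n
  obtain ⟨T, hT⟩ : ∃ T, T = 320 * (L + 2) * ((c + 3) * L) := ⟨_, rfl⟩
  obtain ⟨ℓ, hℓ⟩ : ∃ ℓ, ℓ = 2 * ((c + 6) * L) := ⟨_, rfl⟩
  have hℓ2 : 2 ≤ ℓ := by
    have : 0 < (c + 6) * L := by positivity
    omega
  -- The slack `ℓ` of the size estimate, rounded up to a power of two so that it shifts the level.
  obtain ⟨s, hs1, hs2⟩ : ∃ s, ℓ ≤ 2 ^ s ∧ 2 ^ s ≤ 2 * ℓ := by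
    refine ⟨Nat.clog 2 ℓ, Nat.le_pow_clog (by norm_num) _, ?_⟩
    have h1 : 2 ^ (Nat.clog 2 ℓ - 1) < ℓ := Nat.pow_pred_clog_lt_self (by norm_num) (by omega)
    have h2 : 0 < Nat.clog 2 ℓ := Nat.clog_pos (by norm_num) hℓ2
    have h3 : 2 ^ Nat.clog 2 ℓ = 2 * 2 ^ (Nat.clog 2 ℓ - 1) := by
      rw [← pow_succ', Nat.sub_add_cancel h2]
    omega
  -- Levels are at most L + 1 and recovery uses `lev v + 1 + s`, so `K` is the finest density
  -- needed. The value of `cap` below is the bound of `sum_tests_le`; enforcing it bounds the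
  -- queries for every seed, even after a bad estimate.
  obtain ⟨K, hK⟩ : ∃ K, K = L + 2 + s := ⟨_, rfl⟩
  obtain ⟨k, hk⟩ : ∃ k, k = (c + 4) * L := ⟨_, rfl⟩
  obtain ⟨M, hM⟩ : ∃ M, M = 2 * 2 ^ K * k := ⟨_, rfl⟩
  obtain ⟨cap, hcap⟩ : ∃ cap, cap = 136 * (ℓ * k * (n * L)) := ⟨_, rfl⟩
  refine ⟨SampleSeed (Fin n) L T ×
      (EstimateSeed n L ℓ K × (Fin n → Fin M → Fin n → Fin (2 ^ K))),
    instFintypeProd _ _, inferInstance,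
    fun ω => sampleRound starBIS ω.1 fun H => estimateRound starBIS ω.2.1 H
      (recoverRound s k cap starBIS ω.2.2 H), fun G => ⟨fun ω => ?_, ?_⟩⟩
  · have hstar := isStarQuery_starBIS G
    rw [numQueries_sampleRound hL1 hlt.le hstar, numQueries_estimateRound hstar]
    refine (Nat.add_le_add_left (Nat.add_le_add_left
      (numQueries_recoverRound_le s k cap _ _ _ _ _) _) _).trans ?_
    rw [hcap, hk, hℓ, hT]
    have h2 : L ^ 3 ≤ L ^ 5 := Nat.pow_le_pow_right hL1 (by norm_num)
    have h3 : L ^ 2 ≤ L ^ 5 := Nat.pow_le_pow_right hL1 (by norm_num)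
    have h4 : c + 6 ≤ (c + 6) ^ 2 := Nat.le_self_pow (by norm_num) _
    calc 320 * (L + 2) * ((c + 3) * L) * (n * (L * 2)) + (n * ((L + 2) * (2 * ((c + 6) * L)))
          + 136 * (2 * ((c + 6) * L) * ((c + 4) * L) * (n * L)))
        ≤ 320 * (3 * L) * ((c + 6) * L) * (n * (L * 2)) + (n * (3 * L * (2 * ((c + 6) * L)))
          + 136 * (2 * ((c + 6) * L) * ((c + 6) * L) * (n * L))) := by
          gcongr <;> omega
      _ = 1920 * ((c + 6) * n) * L ^ 3 + 6 * ((c + 6) * n) * L ^ 2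
          + 272 * ((c + 6) ^ 2 * n) * L ^ 3 := by ring
      _ ≤ 1920 * ((c + 6) ^ 2 * n) * L ^ 5 + 6 * ((c + 6) ^ 2 * n) * L ^ 5
          + 272 * ((c + 6) ^ 2 * n) * L ^ 5 := by gcongr
      _ = 2198 * ((c + 6) ^ 2 * (n * L ^ 5)) := by ring
      _ ≤ 2200 * ((c + 6) ^ 2 * (n * L ^ 5)) := by gcongr; norm_num
      _ = _ := by ring
  · have hstar := isStarQuery_starBIS G
    simp only [run_sampleRound hL1 hlt.le hstar, run_estimateRound hstar]
    set Γ := G.toSimpleGraph with hΓ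
    have hlarge := pr_leftover_large_le (V := Fin n) (by simpa using hlt) Γ hT
    rw [Fintype.card_fin] at hlarge
    set δ : ℝ := n * (((L + 2) * ℓ + 1) * ((2 : ℝ) ^ ℓ)⁻¹) + n * (n * ((2 : ℝ) ^ k)⁻¹) with hδ
    have hlater : ∀ ω : SampleSeed (Fin n) L T,
        ¬ ¬ ∑ v, (leftover Γ (sampledGraph Γ ω) v).card ≤ 4 * (n * L) →
        pr (fun ρ : EstimateSeed n L ℓ K × (Fin n → Fin M → Fin n → Fin (2 ^ K)) =>
          ¬ G.IsSpanningForest ((recoverRound s k cap starBIS ρ.2 (sampledGraph Γ ω)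
            (levels Γ (sampledGraph Γ ω) ρ.1)).run G.answerBIS)) ≤ δ := by
      intro ω hω
      rw [not_not] at hω
      have hest := pr_not_goodLevels_le (K := K) Γ (sampledGraph Γ ω) (by omega) hs1 hlt.le
      have hrec : ∀ ρ : EstimateSeed n L ℓ K,
          ¬ ¬ GoodLevels Γ (sampledGraph Γ ω) s (levels Γ (sampledGraph Γ ω) ρ) →
          pr (fun ρ' : Fin n → Fin M → Fin n → Fin (2 ^ K) =>
            ¬ G.IsSpanningForest ((recoverRound s k cap starBIS ρ' (sampledGraph Γ ω)
              (levels Γ (sampledGraph Γ ω) ρ)).run G.answerBIS))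
            ≤ n * (n * ((2 : ℝ) ^ k)⁻¹) := by
        intro ρ hρ
        rw [not_not] at hρ
        refine pr_recoverRound_fail_le G hstar (sampledGraph_le _ ω) (fun v => ?_) hM hρ
          (hcap ▸ sum_tests_le hρ hs2 hL1 hω)
        have : levels Γ (sampledGraph Γ ω) ρ v ≤ L + 1 := estimateLevel_le _ v
        omega
      have hprod := pr_prod_le
        (fun ρ : EstimateSeed n L ℓ K × (Fin n → Fin M → Fin n → Fin (2 ^ K)) =>
          ¬ G.IsSpanningForest ((recoverRound s k cap starBIS ρ.2 (sampledGraph Γ ω)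
            (levels Γ (sampledGraph Γ ω) ρ.1)).run G.answerBIS)) _
        (δ := n * (n * ((2 : ℝ) ^ k)⁻¹)) (by positivity) hrec
      linarith
    have hprod := pr_prod_le
      (fun ω : SampleSeed (Fin n) L T ×
          (EstimateSeed n L ℓ K × (Fin n → Fin M → Fin n → Fin (2 ^ K))) =>
        ¬ G.IsSpanningForest ((recoverRound s k cap starBIS ω.2.2 (sampledGraph Γ ω.1)
          (levels Γ (sampledGraph Γ ω.1) ω.2.1)).run G.answerBIS)) _
      (δ := δ) (by positivity) hlater
    refine le_trans hprod ?_
    refine le_trans (add_le_add hlarge le_rfl) ?_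
    have hn2 : (n : ℝ) ≤ 2 ^ L := by exact_mod_cast hlt.le
    have hL2 : (2 : ℝ) ≤ 2 ^ L := by
      calc (2 : ℝ) = 2 ^ 1 := by norm_num
        _ ≤ 2 ^ L := pow_le_pow_right₀ (by norm_num) hL1
    have herr : ((L + 2) * ℓ + 1) * ((2 : ℝ) ^ ℓ)⁻¹
        ≤ (2 ^ L) ^ 3 * ((2 : ℝ) ^ ((c + 6) * L))⁻¹ := by
      rw [hℓ]
      exact estimate_error_le hL1
    rw [hδ, hk]
    set X : ℝ := 2 ^ L with hX
    have e1 : (2 : ℝ) ^ ((c + 3) * L) = X ^ 3 * X ^ c := by rw [hX]; ring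
    have e2 : (2 : ℝ) ^ ((c + 4) * L) = X ^ 4 * X ^ c := by rw [hX]; ring
    have e3 : (2 : ℝ) ^ ((c + 6) * L) = X ^ 6 * X ^ c := by rw [hX]; ring
    have e4 : (2 : ℝ) ^ (c * L) = X ^ c := by rw [hX]; ring
    have hX0 : 0 < X := by positivity
    rw [e3] at herr
    rw [e1, e2, e4]
    calc n * (X ^ 3 * X ^ c)⁻¹ + (n * (((L + 2) * ℓ + 1) * ((2 : ℝ) ^ ℓ)⁻¹)
          + n * (n * (X ^ 4 * X ^ c)⁻¹))
        ≤ X * (X ^ 3 * X ^ c)⁻¹ + (X * (X ^ 3 * (X ^ 6 * X ^ c)⁻¹)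
          + X * (X * (X ^ 4 * X ^ c)⁻¹)) := by gcongr
      _ = (3 / X ^ 2) * (X ^ c)⁻¹ := by field_simp; norm_num
      _ ≤ 1 * (X ^ c)⁻¹ := by
          gcongr
          rw [div_le_one (by positivity)]
          nlinarith
      _ = _ := one_mul _

end MainAlgorithm

theorem mainTheorem4 :
    (∀ c : ℕ, ∃ C : ℝ, ∀ n : ℕ, 1 ≤ n →
      ∃ A : RandomizedAlgorithm (ORQuery n) (SimpleGraph (Fin n)) 2,
        ∀ G : Multigraph n,
          A.MakesAtMost G.answerOR (C * n * Real.log n ^ 5) ∧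
          A.failureProb G.answerOR G.IsSpanningForest ≤ ((n : ℝ≥0∞) ^ c)⁻¹) ∧
    (∀ c : ℕ, ∃ C : ℝ, ∀ n : ℕ, 1 ≤ n →
      ∃ A : RandomizedAlgorithm (BISQuery n) (SimpleGraph (Fin n)) 4,
        ∀ G : Multigraph n,
          A.MakesAtMost G.answerBIS (C * n * Real.log n ^ 5) ∧
          A.failureProb G.answerBIS G.IsSpanningForest ≤ ((n : ℝ≥0∞) ^ c)⁻¹) :=
  ⟨fun c => exists_algorithm_of_bitLength ORQuery (fun _ G => G.answerOR) 2 c _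
      (exists_algorithm_OR c),
    fun c => exists_algorithm_of_bitLength BISQuery (fun _ G => G.answerBIS) 4 c _
      (exists_algorithm_BIS c)⟩
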